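/- **Setting.** Consider an episodic MDP with state space $\mathcal S$ carrying a volume measure with $\mathrm{Vol}(\mathcal S)\le 1$, finite non-empty action space $\mathcal A$, horizon $H\ge 1$, fixed initial state $s_1$, measurable rewards $r_h:\mathcal S\times\mathcal A\to[0,1]$ and transition densities $P_h(s'\mid s,a)$, $h\in[H]$, with respect to the volume. Write $z=(s,a)$. Assume $P_h(s'\mid z)=\psi_h^*(s')^\top\phi_h^*(z)$ with $\psi_h^*,\phi_h^*$ valued in $\mathbb R^d$, $\|\phi^*_h(z)\|_2\le1$ and $\|\psi^*_h(s')\|_2\le\sqrt d$. Let $\mathcal P^-$ be a probability density on $\mathcal S$ with $\mathcal P^-(s)\ge C_{\mathcal S}^->0$ for all $s$. Let $\Psi$ and $\Phi$ be finite classes of measurable maps $\mathcal S\to\mathbb R^d$ and $\mathcal S\times\mathcal A\to\mathbb R^d$ with $\|\psi(s)\|_2\le\sqrt d/C_{\mathcal S}^-$, $\|\phi(z)\|_2\le1$ and $\psi(s')^\top\phi(z)\ge0$ for all $\psi\in\Psi,\phi\in\Phi$, and such that $\psi_h^*/\mathcal P^-\in\Psi$ and $\phi_h^*\in\Phi$ for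 every $h\in[H]$. Put $|\mathcal F|=|\Psi|\cdot|\Phi|$. For a policy $\pi$ let $d_h^\pi$ be the law of the state at step $h$, let $\tilde d_h^\pi(s,a)=d_h^\pi(s)/|\mathcal A|$, and for $h\ge2$ let $\breve d_h^\pi$ be the law of $(s,a)$ when $z'\sim\tilde d_{h-1}^\pi$, $s\sim P_{h-1}(\cdot\mid z')$ and $a$ is uniform on $\mathcal A$. **Algorithm (Contrastive UCB).** Let $\pi^0$ be the uniform policy and let $(\lambda_k),(\gamma_k)$ be real sequences. In round $k\ge1$: 1. *Sampling.* Independently for each $h\in[H]$, draw $(\tilde s_h,\tilde a_h)\sim\tilde d_h^{\pi^{k-1}}$, then $\tilde s_{h+1}\sim P_h(\cdot\mid\tilde s_h,\tilde a_h)$ and a label $y_h\sim\mathrm{Ber}(1/2)$. If $h<H$, put $\breve s_{h+1}=\tilde s_{h+1}$ and draw $\breve a_{h+1}$ uniformly from $\mathcal A$ and $\breve s_{h+2}\sim P_{h+1}(\cdot\mid\breve s_{h+1},\breve a_{h+1})$. If $y_h=0$, replace the next states $\tilde s_{h+1}$ and $\breve s_{h+2}$ in the recorded samples by independent draws from $\mathcal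 P^-$. Add the sample (state, action, next state, label $y_h$) that starts at $(\tilde s_h,\tilde a_h)$ to the data set $\mathcal D_h^k$, which contains $\mathcal D_h^{k-1}$. If $h<H$, also add the sample with the same label that starts at $(\breve s_{h+1},\breve a_{h+1})$ to $\mathcal D_{h+1}^k$. 2. *Contrastive learning.* For each $h$ let $(\tilde\psi_h^k,\tilde\phi_h^k)$ minimize over $\Psi\times\Phi$ the average over $(z,s',y)\in\mathcal D_h^k$ of $y\log\big(1+1/\psi(s')^\top\phi(z)\big)+(1-y)\log\big(1+\psi(s')^\top\phi(z)\big)$, with $\log(1+1/0)=+\infty$. 3. *Normalization.* Set $\hat\psi_h^k(s')=\mathcal P^-(s')\tilde\psi_h^k(s')$, $\hat\phi_h^k(z)=\tilde\phi_h^k(z)\big/\int\mathcal P^-(s')\tilde\phi_h^k(z)^\top\tilde\psi_h^k(s')\,ds'$ (set to $0$ if the denominator is $0$), and $\hat P_h^k(s'\mid z)=\hat\psi_h^k(s')^\top\hat\phi_h^k(z)$. 4. *Planning.* Let $\hat\Sigma_h^k=\frac1k\sum_{\tau=1}^k\hat\phi_h^k(\tilde z_h^\tau)\hat\phi_h^k(\tilde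 z_h^\tau)^\top+\lambda_kI$, where $\tilde z_h^\tau$ is the pair $(\tilde s_h,\tilde a_h)$ of round $\tau$, and $\beta_h^k(z)=\min\{\gamma_k\|\hat\phi_h^k(z)\|_{(\hat\Sigma_h^k)^{-1}},2H\}$. With $\overline V^k_{H+1}=0$ let $\overline Q_h^k(z)=r_h(z)+\beta_h^k(z)+\int\hat P_h^k(s'\mid z)\overline V_{h+1}^k(s')\,ds'$ and $\overline V_h^k(s)=\max_a\overline Q_h^k(s,a)$, and let $\pi_h^k(s)\in\arg\max_a\overline Q_h^k(s,a)$. Ties in the two minimization/maximization steps are resolved by any fixed measurable rule. **Lemma (Transition Recovery).** Let $\tilde\rho_h^k=\frac1k\sum_{k'=0}^{k-1}\tilde d_h^{\pi^{k'}}$ and $\breve\rho_h^k=\frac1k\sum_{k'=0}^{k-1}\breve d_h^{\pi^{k'}}$. For every $k\ge1$ and $\delta\in(0,1)$, after $k$ rounds of the algorithm, with probability at least $1-2\delta$ the following bounds hold simultaneously: $$\mathbb E_{z\sim\tilde\rho_h^k}\big\|P_h(\cdot\mid z)-\hat P_h^k(\cdot\mid z)\big\|_1^2\le\frac{32d}{(C_{\mathcal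 S}^-)^2}\cdot\frac{\log(2kH|\mathcal F|/\delta)}{k}\qquad\text{for all }1\le h\le H,$$ $$\mathbb E_{z\sim\breve\rho_h^k}\big\|P_h(\cdot\mid z)-\hat P_h^k(\cdot\mid z)\big\|_1^2\le\frac{32d}{(C_{\mathcal S}^-)^2}\cdot\frac{\log(2kH|\mathcal F|/\delta)}{k}\qquad\text{for all }2\le h\le H,$$ where $\|f\|_1=\int_{\mathcal S}|f(s')|\,ds'$. -/

import Mathlib

open MeasureTheory ProbabilityTheory
open scoped ENNReal

noncomputable section

namespace ContrastiveRL

variable {S A T : Type*} [MeasurableSpace S] [MeasurableSpace A] [MeasurableSpace T]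

/-- The feature space `ℝ^d` with its Euclidean norm. -/
abbrev Feat (d : ℕ) := EuclideanSpace ℝ (Fin d)

/-! ### The Markov decision process -/

/-- An episodic MDP with horizon `H`, a fixed initial state, rewards in `[0,1]` and transition
densities `P h (s, a) s'` with respect to a volume measure of total mass at most one.
The steps are `1, …, H`; nothing is required of other indices. -/
structure MDP (S A : Type*) [MeasurableSpace S] [MeasurableSpace A] where
  vol : Measure S
  vol_le_one : vol Set.univ ≤ 1
  H : ℕ
  H_pos : 1 ≤ H
  s₁ : S
  r : ℕ → S × A → ℝ
  r_measurable : ∀ h ∈ Finset.Icc 1 H, Measurable (r h)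
  r_mem : ∀ h ∈ Finset.Icc 1 H, ∀ z, r h z ∈ Set.Icc (0 : ℝ) 1
  P : ℕ → S × A → S → ℝ
  P_measurable : ∀ h ∈ Finset.Icc 1 H, Measurable (Function.uncurry (P h))
  P_nonneg : ∀ h ∈ Finset.Icc 1 H, ∀ z s', 0 ≤ P h z s'
  P_density : ∀ h ∈ Finset.Icc 1 H, ∀ z, ∫⁻ s', ENNReal.ofReal (P h z s') ∂vol = 1

instance (M : MDP S A) : IsFiniteMeasure M.vol :=
  ⟨lt_of_le_of_lt M.vol_le_one ENNReal.one_lt_top⟩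

/-- The low-rank decomposition `P_h(s' | z) = ψ*_h(s')ᵀ φ*_h(z)` with its norm bounds. -/
structure MDP.IsLowRank (M : MDP S A) {d : ℕ} (ψs : ℕ → S → Feat d) (φs : ℕ → S × A → Feat d) :
    Prop where
  eq_inner : ∀ h ∈ Finset.Icc 1 M.H, ∀ z s', M.P h z s' = inner ℝ (ψs h s') (φs h z)
  norm_φ_le : ∀ h ∈ Finset.Icc 1 M.H, ∀ z, ‖φs h z‖ ≤ 1
  norm_ψ_le : ∀ h ∈ Finset.Icc 1 M.H, ∀ s', ‖ψs h s'‖ ≤ Real.sqrt d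

/-- `neg` is a probability density (with respect to the volume measure) bounded below by the
constant `C > 0`: the negative sampling distribution. -/
structure MDP.IsNegativeDensity (M : MDP S A) (neg : S → ℝ) (C : ℝ) : Prop where
  measurable : Measurable neg
  density : ∫⁻ s', ENNReal.ofReal (neg s') ∂M.vol = 1
  pos : 0 < C
  le : ∀ s, C ≤ neg s

/-- The finite classes `Ψ` and `Φ` of candidate features: measurable functions with the norm bounds
`√d / C` and `1`, whose products `ψ(s')ᵀ φ(z)` are non-negative (they model density ratios). -/
structure IsFunctionClass {d : ℕ} (C : ℝ) (Ψ : Finset (S → Feat d)) (Φ : Finset (S × A → Feat d)) :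
    Prop where
  measurable_ψ : ∀ ψ ∈ Ψ, Measurable ψ
  measurable_φ : ∀ φ ∈ Φ, Measurable φ
  norm_ψ_le : ∀ ψ ∈ Ψ, ∀ s, ‖ψ s‖ ≤ Real.sqrt d / C
  norm_φ_le : ∀ φ ∈ Φ, ∀ z, ‖φ z‖ ≤ 1
  inner_nonneg : ∀ ψ ∈ Ψ, ∀ φ ∈ Φ, ∀ s z, 0 ≤ inner ℝ (ψ s) (φ z)

/-! ### State-action distributions

A policy that depends on a parameter `t : T` (later: the history of the algorithm) is a family
`π h : Kernel (T × S) A`. All distributions induced by it are kernels with source `T`. -/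

/-- The transition kernel at step `h`. -/
def MDP.trans (M : MDP S A) (h : ℕ) : Kernel (S × A) S :=
  Kernel.withDensity (Kernel.const _ M.vol) fun z s' => ENNReal.ofReal (M.P h z s')

/-- The law of the state at step `n + 1`. -/
def MDP.stateLaw (M : MDP S A) (π : ℕ → Kernel (T × S) A) : ℕ → Kernel T S
  | 0 => Kernel.const T (Measure.dirac M.s₁)
  | n + 1 => M.trans (n + 1) ∘ₖ (M.stateLaw π n ⊗ₖ π (n + 1))

/-- `d^π_h`, the law of the state at step `h ≥ 1`. -/
def MDP.stateDist (M : MDP S A) (π : ℕ → Kernel (T × S) A) (h : ℕ) : Kernel T S :=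
  M.stateLaw π (h - 1)

/-- The uniform distribution on the finite action space. -/
def unif (A : Type*) [MeasurableSpace A] [Fintype A] [Nonempty A] : Measure A :=
  (PMF.uniformOfFintype A).toMeasure

variable [Fintype A] [Nonempty A]

/-- `d̃^π_h(s, a) = d^π_h(s) Unif(a)`. -/
def MDP.dTilde (M : MDP S A) (π : ℕ → Kernel (T × S) A) (h : ℕ) : Kernel T (S × A) :=
  M.stateDist π h ×ₖ Kernel.const T (unif A)

/-- `d̆^π_h(s, a) = ∫ d̃^π_{h-1}(s', a') P_{h-1}(s | s', a') Unif(a)`, for `h ≥ 2`. -/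
def MDP.dBreve (M : MDP S A) (π : ℕ → Kernel (T × S) A) (h : ℕ) : Kernel T (S × A) :=
  (M.trans (h - 1) ∘ₖ M.dTilde π (h - 1)) ×ₖ Kernel.const T (unif A)

/-! ### Data collection -/

/-- A labelled transition `((s, a), s', y)`; `y = true` marks a positive sample. -/
abbrev Sample (S A : Type*) := (S × A) × S × Bool

/-- The data of one round: for each step `h = 1, …, H-1` (index `h - 1`) the labelled transition
at step `h` and the continued one at step `h + 1`, and a labelled transition at step `H`. -/
abbrev Round (S A : Type*) (H : ℕ) := (Fin (H - 1) → Sample S A × Sample S A) × Sample S A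

/-- The data of the first `k` rounds. -/
abbrev History (S A : Type*) (H k : ℕ) := Fin k → Round S A H

/-- The data of the first `j` of `k` rounds. -/
def History.take {H k : ℕ} (D : History S A H k) (j : Fin k) : History S A H j :=
  fun i => D (Fin.castLE j.isLt.le i)

/-- The Bernoulli(1/2) distribution of the labels. -/
def coin : Measure Bool := unif Bool

/-- The negative sampling distribution. -/
def MDP.negMeasure (M : MDP S A) (neg : S → ℝ) : Measure S :=
  M.vol.withDensity fun s => ENNReal.ofReal (neg s)

/-- One sampling iteration at step `h < H`, given `z = (s̃_h, ã_h)`: draw the next state `s̃_{h+1}`,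
an action `ă_{h+1} ∼ Unif`, a further state `s̆_{h+2}`, one label `y ∼ Ber(1/2)` and two negative
states, and replace both next states by the negative ones if the label is `0`. -/
def MDP.stepKernel (M : MDP S A) (neg : S → ℝ) (h : ℕ) :
    Kernel (S × A) (Sample S A × Sample S A) :=
  (Kernel.id ×ₖ
    (((M.trans h ×ₖ Kernel.const _ (unif A)) ⊗ₖ Kernel.prodMkLeft (S × A) (M.trans (h + 1))) ×ₖ
      Kernel.const _ (coin.prod ((M.negMeasure neg).prod (M.negMeasure neg))))).map
    fun p : (S × A) × (((S × A) × S) × (Bool × (S × S))) =>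
      let z := p.1
      let z' := p.2.1.1
      let s'' := p.2.1.2
      let y := p.2.2.1
      let n := p.2.2.2
      ((z, (if y then z'.1 else n.1), y), (z', (if y then s'' else n.2), y))

/-- The sampling iteration at the last step, given `z = (s̃_H, ã_H)`. -/
def MDP.lastKernel (M : MDP S A) (neg : S → ℝ) : Kernel (S × A) (Sample S A) :=
  (Kernel.id ×ₖ (M.trans M.H ×ₖ Kernel.const _ (coin.prod (M.negMeasure neg)))).map
    fun p : (S × A) × (S × (Bool × S)) =>
      (p.1, (if p.2.2.1 then p.2.1 else p.2.2.2), p.2.2.1)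

/-- The independent product of finitely many kernels with the same source. -/
def piKernel {X : Type*} [MeasurableSpace X] : (n : ℕ) → (Fin n → Kernel T X) → Kernel T (Fin n → X)
  | 0, _ => Kernel.const T (Measure.dirac Fin.elim0)
  | n + 1, κ => (κ 0 ×ₖ piKernel n fun i => κ i.succ).map
      fun p => (Fin.cons p.1 p.2 : Fin (n + 1) → X)

/-- The law of the data of one round collected with the policy `π`: at every step `h` a fresh
`(s̃_h, ã_h) ∼ d̃^π_h`, followed by the sampling iteration, independently over `h`. -/
def MDP.roundKernel (M : MDP S A) (neg : S → ℝ) (π : ℕ → Kernel (T × S) A) :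
    Kernel T (Round S A M.H) :=
  piKernel (M.H - 1) (fun i => M.stepKernel neg (i + 1) ∘ₖ M.dTilde π (i + 1)) ×ₖ
    (M.lastKernel neg ∘ₖ M.dTilde π M.H)

/-- The sample that one round generates at step `h` from `d̃_h`. -/
def tildeSample {H : ℕ} (R : Round S A H) (h : ℕ) : Sample S A :=
  if hh : h - 1 < H - 1 then (R.1 ⟨h - 1, hh⟩).1 else R.2

/-- What one round adds to the contrastive data set of step `h`: the sample from `d̃_h` and, for
`h ≥ 2`, the sample from `d̆_h`. -/
def roundData {H : ℕ} (R : Round S A H) (h : ℕ) : Multiset (Sample S A) :=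
  {tildeSample R h} +
    if hh : 2 ≤ h ∧ h ≤ H then {(R.1 ⟨h - 2, by omega⟩).2} else 0

/-- The contrastive data set `D_h^k`. -/
def dataset {H k : ℕ} (D : History S A H k) (h : ℕ) : Multiset (Sample S A) :=
  ∑ τ, roundData (D τ) h

/-! ### Contrastive loss -/

/-- The loss `y log(1 + 1/t) + (1 - y) log(1 + t)` of a ratio `t ≥ 0`, with `log(1 + 1/0) = ∞`. -/
def pointLoss (t : ℝ) (y : Bool) : ℝ≥0∞ :=
  if y then (if t = 0 then ⊤ else ENNReal.ofReal (Real.log (1 + 1 / t)))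
  else ENNReal.ofReal (Real.log (1 + t))

/-- The contrastive loss: the average of the pointwise loss over a data set. -/
def contrastiveLoss {d : ℕ} (ψ : S → Feat d) (φ : S × A → Feat d) (D : Multiset (Sample S A)) :
    ℝ≥0∞ :=
  (D.map fun x => pointLoss (inner ℝ (ψ x.2.1) (φ x.1)) x.2.2).sum / (D.card : ℝ≥0∞)

/-! ### Normalization, bonus and planning -/

/-- `ψ̂(s') = P⁻(s') ψ̃(s')`. -/
def psiHat {d : ℕ} (neg : S → ℝ) (ψ : S → Feat d) (s' : S) : Feat d := neg s' • ψ s'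

/-- `φ̂(z) = φ̃(z) / ∫ P⁻(s') φ̃(z)ᵀ ψ̃(s') ds'`. -/
def MDP.phiHat (M : MDP S A) {d : ℕ} (neg : S → ℝ) (ψ : S → Feat d) (φ : S × A → Feat d)
    (z : S × A) : Feat d :=
  (∫ s', neg s' * inner ℝ (φ z) (ψ s') ∂M.vol)⁻¹ • φ z

/-- `P̂(s' | z) = ψ̂(s')ᵀ φ̂(z)`. -/
def MDP.PHat (M : MDP S A) {d : ℕ} (neg : S → ℝ) (ψ : S → Feat d) (φ : S × A → Feat d)
    (z : S × A) (s' : S) : ℝ :=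
  inner ℝ (psiHat neg ψ s') (M.phiHat neg ψ φ z)

/-- `Σ̂ = (1/k) ∑_τ φ̂(z_τ) φ̂(z_τ)ᵀ + λ I`. -/
def covariance {d k : ℕ} (lam : ℝ) (φ : S × A → Feat d) (z : Fin k → S × A) :
    Matrix (Fin d) (Fin d) ℝ :=
  (1 / (k : ℝ)) • ∑ τ, Matrix.vecMulVec (WithLp.ofLp (φ (z τ))) (WithLp.ofLp (φ (z τ)))
    + lam • (1 : Matrix (Fin d) (Fin d) ℝ)

/-- The bonus `min {γ ‖φ̂(z)‖_{Σ⁻¹}, 2H}`, where `‖x‖_Λ = √(xᵀ Λ x)`. -/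
def bonus {d : ℕ} (gam : ℝ) (H : ℕ) (Sig : Matrix (Fin d) (Fin d) ℝ) (x : Feat d) : ℝ :=
  min (gam * Real.sqrt (WithLp.ofLp x ⬝ᵥ (Sig⁻¹.mulVec (WithLp.ofLp x)))) (2 * H)

/-- Optimistic value iteration: `valueToGo j` is the value function at step `H + 1 - j`. -/
def MDP.valueToGo (M : MDP S A) (β : ℕ → S × A → ℝ) (Phat : ℕ → S × A → S → ℝ) : ℕ → S → ℝ
  | 0, _ => 0
  | j + 1, s => Finset.univ.sup' Finset.univ_nonempty fun a : A =>
      M.r (M.H - j) (s, a) + β (M.H - j) (s, a)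
        + ∫ s', Phat (M.H - j) (s, a) s' * M.valueToGo β Phat j s' ∂M.vol

/-- The optimistic Q-function `Q_h = r_h + β_h + P̂_h V_{h+1}` at step `h`. -/
def MDP.qValue (M : MDP S A) (β : ℕ → S × A → ℝ) (Phat : ℕ → S × A → S → ℝ) (h : ℕ)
    (z : S × A) : ℝ :=
  M.r h z + β h z + ∫ s', Phat h z s' * M.valueToGo β Phat (M.H - h) s' ∂M.vol

/-- The Q-function that the algorithm computes at episode `k` from the learned features and the
data collected so far. -/
def MDP.qEstimate (M : MDP S A) {d k : ℕ} (neg : S → ℝ) (lam gam : ℝ) (ψ : ℕ → S → Feat d)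
    (φ : ℕ → S × A → Feat d) (D : History S A M.H k) : ℕ → S × A → ℝ :=
  M.qValue
    (fun h z => bonus gam M.H
      (covariance lam (M.phiHat neg (ψ h) (φ h)) fun τ => (tildeSample (D τ) h).1)
      (M.phiHat neg (ψ h) (φ h) z))
    (fun h => M.PHat neg (ψ h) (φ h))

/-! ### The algorithm -/

/-- Contrastive UCB with a (measurable) way to resolve ties in its two optimization steps.
After `k` rounds with data `D`, the features `(ψt k h D, φt k h D)` minimize the contrastive loss
over `Ψ × Φ`, and `action k h` is greedy for the optimistic Q-function. -/
structure ContrastiveUCB (M : MDP S A) {d : ℕ} (neg : S → ℝ) (Ψ : Finset (S → Feat d))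
    (Φ : Finset (S × A → Feat d)) (lam gam : ℕ → ℝ) where
  ψt : (k : ℕ) → ℕ → History S A M.H k → S → Feat d
  φt : (k : ℕ) → ℕ → History S A M.H k → S × A → Feat d
  action : (k : ℕ) → ℕ → History S A M.H k × S → A
  ψt_mem : ∀ k, 1 ≤ k → ∀ h ∈ Finset.Icc 1 M.H, ∀ D, ψt k h D ∈ Ψ
  φt_mem : ∀ k, 1 ≤ k → ∀ h ∈ Finset.Icc 1 M.H, ∀ D, φt k h D ∈ Φ
  minimizes : ∀ k, 1 ≤ k → ∀ h ∈ Finset.Icc 1 M.H, ∀ D, ∀ ψ ∈ Ψ, ∀ φ ∈ Φ,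
    contrastiveLoss (ψt k h D) (φt k h D) (dataset D h) ≤ contrastiveLoss ψ φ (dataset D h)
  ψt_measurable : ∀ k, 1 ≤ k → ∀ h ∈ Finset.Icc 1 M.H, ∀ ψ, MeasurableSet {D | ψt k h D = ψ}
  φt_measurable : ∀ k, 1 ≤ k → ∀ h ∈ Finset.Icc 1 M.H, ∀ φ, MeasurableSet {D | φt k h D = φ}
  greedy : ∀ k, 1 ≤ k → ∀ h ∈ Finset.Icc 1 M.H, ∀ D s a,
    M.qEstimate neg (lam k) (gam k) (fun h => ψt k h D) (fun h => φt k h D) D h (s, a) ≤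
      M.qEstimate neg (lam k) (gam k) (fun h => ψt k h D) (fun h => φt k h D) D h
        (s, action k h (D, s))
  action_measurable : ∀ k h, Measurable (action k h)

namespace ContrastiveUCB

variable {M : MDP S A} {d : ℕ} {neg : S → ℝ} {Ψ : Finset (S → Feat d)}
  {Φ : Finset (S × A → Feat d)} {lam gam : ℕ → ℝ}

/-- The policy `π^k`, given the data of the first `k` rounds: uniform for `k = 0`, greedy after. -/
def policy (alg : ContrastiveUCB M neg Ψ Φ lam gam) (k h : ℕ) :
    Kernel (History S A M.H k × S) A :=
  if k = 0 then Kernel.const _ (unif A)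
  else Kernel.deterministic (alg.action k h) (alg.action_measurable k h)

/-- The law of the data of the first `k` rounds; round `k + 1` is collected with `π^k`. -/
def historyLaw (alg : ContrastiveUCB M neg Ψ Φ lam gam) : (k : ℕ) → Measure (History S A M.H k)
  | 0 => Measure.dirac Fin.elim0
  | k + 1 => (alg.historyLaw k ⊗ₘ M.roundKernel neg (alg.policy k)).map
      fun p => (Fin.snoc p.1 p.2 : Fin (k + 1) → Round S A M.H)

/-- `ρ̃_h^k = (1/k) ∑_{j < k} d̃_h^{π^j}`. -/
def rhoTilde (alg : ContrastiveUCB M neg Ψ Φ lam gam) (k h : ℕ) (D : History S A M.H k) :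
    Measure (S × A) :=
  (k : ℝ≥0∞)⁻¹ • ∑ j : Fin k, M.dTilde (alg.policy j) h (History.take D j)

/-- `ρ̆_h^k = (1/k) ∑_{j < k} d̆_h^{π^j}`. -/
def rhoBreve (alg : ContrastiveUCB M neg Ψ Φ lam gam) (k h : ℕ) (D : History S A M.H k) :
    Measure (S × A) :=
  (k : ℝ≥0∞)⁻¹ • ∑ j : Fin k, M.dBreve (alg.policy j) h (History.take D j)

/-- The estimated transition density `P̂_h^k`. -/
def estimate (alg : ContrastiveUCB M neg Ψ Φ lam gam) (k h : ℕ) (D : History S A M.H k) :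
    S × A → S → ℝ :=
  M.PHat neg (alg.ψt k h D) (alg.φt k h D)

/-- `E_{z ∼ ρ} ‖P_h(· | z) - P̂_h^k(· | z)‖₁²`. -/
def transitionError (alg : ContrastiveUCB M neg Ψ Φ lam gam) (k h : ℕ) (D : History S A M.H k)
    (ρ : Measure (S × A)) : ℝ≥0∞ :=
  ∫⁻ z, (∫⁻ s', ‖M.P h z s' - alg.estimate k h D z s'‖ₑ ∂M.vol) ^ 2 ∂ρ

end ContrastiveUCB

end ContrastiveRL

end

/-!
The learner fits the posterior probability of a label: if a positive sample has density ratio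
`g = P / P⁻`, the label given `(z, s')` is positive with probability `g / (1 + g)`, and the
contrastive loss is the negative log-likelihood of a candidate ratio `w` in this model. So the
learned ratio is a maximum likelihood estimator, and the proof is the Hellinger analysis of maximum
likelihood over a finite class, for adaptively collected data.

*One transition.* Put `B = √d / C`, a bound on all ratios. For a fixed `z`, the mean of the square
root of the likelihood ratio of `w` against `g` is at most `1 - ∫ (√g - √w)² dP⁻ / (4 (1 + B))`
(`sqrtRatio_add_sq_le`). The estimate `P̂` normalizes `P⁻ w`; with `b` the Hellinger affinity of `P`
and `P̂` and `Z` the mass of `P⁻ w`, one has `‖P - P̂‖₁² ≤ 4 (1 - b²) ≤ 4 (1 + Z - 2 √Z b)`, and the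
right side is `4 ∫ (√g - √w)² dP⁻`, whatever `Z` is (`sq_integral_abs_sub_normalized_le`).
As `B ≥ 1` because densities integrate to one, the mean is at most `1 - ‖P - P̂‖₁² / (32 B²)`
(`integral_sqrtRatio_add_le`, `MDP.labelledMean_sqrtRatio_add_le`).

*Many rounds.* A round contributes to the data set of step `h` a sample from `d̃_h` and one from
`d̆_h`, independent given the past (`MDP.lintegral_prod_map_roundData`). Hence for a fixed candidate
the product of the root likelihood ratios, times the exponential of the accumulated conditional mean
errors, has mean at most one (`ContrastiveUCB.lintegral_prod_dataset_mul_exp_le`). By Markov's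
inequality and a union bound over `h` and the `|F|` candidates, with probability at least `1 - δ`
every such product is below `H |F| / δ`. For the learned candidate the likelihood part is at least
one (`ContrastiveUCB.one_le_prod_learned`), so its accumulated error over both sampling
distributions is at most `32 B² log (H |F| / δ)`. The true ratio has infinite loss only when it
vanishes at a positive sample, which has probability zero
(`ContrastiveUCB.historyLaw_exists_pointLoss_eq_top`).
-/

/-! ### The Hellinger bound for a density ratio -/

namespace ContrastiveRL

/-- The conditional probability of the label `y` under the density ratio `t`. -/
noncomputable def labelProb (t : ℝ) (y : Bool) : ℝ := if y then t / (1 + t) else 1 / (1 + t)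

/-- The square root of the likelihood ratio of a label under the candidate density ratio `t` and
the reference `t₀`. It is `0` when `t₀ = 0` and `y = true`, an event of probability zero under the
reference. -/
noncomputable def sqrtRatio (t₀ t : ℝ) (y : Bool) : ℝ := √(labelProb t y / labelProb t₀ y)

theorem sqrtRatio_nonneg (t₀ t : ℝ) (y : Bool) : 0 ≤ sqrtRatio t₀ t y := Real.sqrt_nonneg _

theorem measurable_sqrtRatio (y : Bool) :
    Measurable fun p : ℝ × ℝ => sqrtRatio p.1 p.2 y := by
  cases y <;> simp only [sqrtRatio, labelProb] <;> simp <;> fun_prop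

theorem mul_sqrtRatio_true {g w : ℝ} (hg : 0 ≤ g) (hw : 0 ≤ w) :
    g * sqrtRatio g w true = √(1 + g) / √(1 + w) * (√g * √w) := by
  rcases hg.eq_or_lt with rfl | hg'
  · simp
  have h1 : sqrtRatio g w true = √w * √(1 + g) / (√(1 + w) * √g) := by
    simp only [sqrtRatio, labelProb, if_true]
    rw [← Real.sqrt_mul hw, ← Real.sqrt_mul (by positivity), ← Real.sqrt_div (by positivity)]
    congr 1
    field_simp
  have h2 : 0 < √g := Real.sqrt_pos.2 hg'
  have h3 : 0 < √(1 + w) := Real.sqrt_pos.2 (by positivity)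
  rw [h1]
  nth_rewrite 1 [← Real.mul_self_sqrt hg]
  field_simp

theorem sqrtRatio_false {g w : ℝ} (hg : 0 ≤ g) (hw : 0 ≤ w) :
    sqrtRatio g w false = √(1 + g) / √(1 + w) := by
  simp only [sqrtRatio, labelProb]
  rw [← Real.sqrt_div (by positivity)]
  congr 1
  simp only [Bool.false_eq_true, if_false]
  field_simp

/-- The pointwise Hellinger bound. With `c = (1 + √g √w) / (√(1 + g) √(1 + w))`, the cosine of an
angle, it reduces to `0 ≤ (1 - c)²`. -/
theorem sqrtRatio_add_sq_le {g w B : ℝ} (hg : 0 ≤ g) (hw : 0 ≤ w) (hwB : w ≤ B) :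
    (g * sqrtRatio g w true + sqrtRatio g w false) / 2 + (√g - √w) ^ 2 / (4 * (1 + B))
      ≤ (1 + g) / 2 := by
  have hD : 0 < √(1 + w) := Real.sqrt_pos.2 (by positivity)
  have hA : 0 < √(1 + g) := Real.sqrt_pos.2 (by positivity)
  have hA2 : √(1 + g) ^ 2 = 1 + g := Real.sq_sqrt (by positivity)
  have hD2 : √(1 + w) ^ 2 = 1 + w := Real.sq_sqrt (by positivity)
  have hx : √g ^ 2 = g := Real.sq_sqrt hg
  have hy : √w ^ 2 = w := Real.sq_sqrt hw
  have h1 : (√g - √w) ^ 2 / (4 * (1 + B)) ≤ (√g - √w) ^ 2 / (4 * (1 + w)) := by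
    gcongr
  refine (add_le_add_right h1 _).trans ?_
  rw [mul_sqrtRatio_true hg hw, sqrtRatio_false hg hw]
  set x := √g
  set y := √w
  set a := √(1 + g)
  set b := √(1 + w)
  set c := (1 + x * y) / (a * b) with hc
  have hab : c * (a * b) = 1 + x * y := by rw [hc]; field_simp
  have e1 : (x - y) ^ 2 / (4 * (1 + w)) = (1 - c ^ 2) * a ^ 2 / 4 := by
    rw [← hD2, div_eq_div_iff (by positivity) (by positivity)]
    have h2 : (c * (a * b)) ^ 2 = (1 + x * y) ^ 2 := by rw [hab]
    have h3 : a ^ 2 * b ^ 2 = (1 + x ^ 2) * (1 + y ^ 2) := by rw [hA2, hD2, hx, hy]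
    linear_combination (-4) * h3 + 4 * h2
  have e2 : (a / b * (x * y) + a / b) / 2 = c * a ^ 2 / 2 := by
    rw [hc]
    field_simp
    ring
  rw [e1, e2, ← hA2]
  nlinarith [mul_nonneg (sq_nonneg a) (sq_nonneg (1 - c))]

section Hellinger

variable {S : Type*} [MeasurableSpace S] {ν : Measure S} [IsProbabilityMeasure ν]
  {g w : S → ℝ} {B : ℝ}

theorem integrable_of_nonneg_of_le {f : S → ℝ} (hf : Measurable f) (h0 : ∀ s, 0 ≤ f s) {c : ℝ}
    (hc : ∀ s, f s ≤ c) : Integrable f ν :=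
  Integrable.of_bound hf.aestronglyMeasurable c
    (Filter.Eventually.of_forall fun s => by rw [Real.norm_of_nonneg (h0 s)]; exact hc s)

/-- Normalizing an unnormalized density costs nothing in the Hellinger bound on the `L¹` distance:
with `b` the Hellinger affinity of `g` and the normalized `w`, and `Z` the mass of `w`,
`‖g - w / Z‖₁² ≤ 4 (1 - b²)` and `1 - b² ≤ 1 + Z - 2 √Z b = ∫ (√g - √w)²`. -/
theorem sq_integral_abs_sub_normalized_le (hg : Measurable g) (hw : Measurable w)
    (hg0 : ∀ s, 0 ≤ g s) (hw0 : ∀ s, 0 ≤ w s) (hgB : ∀ s, g s ≤ B) (hwB : ∀ s, w s ≤ B)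
    (hg1 : ∫ s, g s ∂ν = 1) :
    (∫ s, |g s - (∫ t, w t ∂ν)⁻¹ * w s| ∂ν) ^ 2 ≤ 4 * ∫ s, (√(g s) - √(w s)) ^ 2 ∂ν := by
  set Z := ∫ t, w t ∂ν with hZ
  have hZ0 : 0 ≤ Z := integral_nonneg hw0
  have ig : Integrable g ν := integrable_of_nonneg_of_le hg hg0 hgB
  have iw : Integrable w ν := integrable_of_nonneg_of_le hw hw0 hwB
  have isq : ∀ s, √(g s) * √(w s) ≤ B := fun s => by
    have hB : 0 ≤ B := (hg0 s).trans (hgB s)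
    calc √(g s) * √(w s) ≤ √B * √B := by gcongr <;> [exact hgB s; exact hwB s]
      _ = B := Real.mul_self_sqrt hB
  have igw : Integrable (fun s => √(g s) * √(w s)) ν :=
    integrable_of_nonneg_of_le (by fun_prop) (fun s => by positivity) isq
  have hK : ∫ s, (√(g s) - √(w s)) ^ 2 ∂ν = 1 + Z - 2 * ∫ s, √(g s) * √(w s) ∂ν := by
    have : ∀ s, (√(g s) - √(w s)) ^ 2 = g s + w s - 2 * (√(g s) * √(w s)) := fun s => by
      have := Real.sq_sqrt (hg0 s)
      have := Real.sq_sqrt (hw0 s)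
      nlinarith
    simp_rw [this]
    have igpw : Integrable (fun s => g s + w s) ν := ig.add iw
    rw [integral_sub igpw (igw.const_mul 2), integral_add ig iw, hg1, integral_const_mul]
  rw [hK]
  rcases hZ0.eq_or_lt with h0 | hpos
  -- For `Z = 0` the convention `0⁻¹ = 0` makes the normalized candidate vanish.
  · have hw_ae : w =ᵐ[ν] 0 := (integral_eq_zero_iff_of_nonneg hw0 iw).1 (by rw [← hZ, ← h0])
    have hb : ∫ s, √(g s) * √(w s) ∂ν = 0 := by
      rw [integral_eq_zero_of_ae]
      filter_upwards [hw_ae] with s hs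
      simp [hs]
    have hX : ∫ s, |g s - Z⁻¹ * w s| ∂ν = 1 := by
      rw [← hg1]
      refine integral_congr_ae (Filter.Eventually.of_forall fun s => ?_)
      simp [← h0, abs_of_nonneg (hg0 s)]
    rw [hX, hb, ← h0]
    norm_num
  · set b := (√Z)⁻¹ * ∫ s, √(g s) * √(w s) ∂ν with hb
    have hsZ : 0 < √Z := Real.sqrt_pos.2 hpos
    have hbe : ∫ s, √(g s) * √(w s) ∂ν = √Z * b := by rw [hb]; field_simp
    set q : S → ℝ := fun s => Z⁻¹ * w s with hq
    have hq0 : ∀ s, 0 ≤ q s := fun s => mul_nonneg (by positivity) (hw0 s)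
    have iq : Integrable q ν := iw.const_mul _
    have hq1 : ∫ s, q s ∂ν = 1 := by
      rw [hq, integral_const_mul, ← hZ, inv_mul_cancel₀ hpos.ne']
    have hqs : ∀ s, √(g s) * √(q s) = (√Z)⁻¹ * (√(g s) * √(w s)) := fun s => by
      rw [hq, Real.sqrt_mul (by positivity), Real.sqrt_inv]; ring
    have igq : Integrable (fun s => √(g s) * √(q s)) ν := by
      simp_rw [hqs]; exact igw.const_mul _
    have hbq : ∫ s, √(g s) * √(q s) ∂ν = b := by
      simp_rw [hqs]; rw [integral_const_mul]
    have iX : Integrable (fun s => |g s - q s|) ν := (ig.sub iq).abs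
    set X := ∫ s, |g s - q s| ∂ν with hX
    -- Cauchy-Schwarz for `|g - q| = |√g - √q| (√g + √q)`, through the discriminant in `t`.
    have key : ∀ t : ℝ, 0 ≤ (2 - 2 * b) * (t * t) + (2 * X) * t + (2 + 2 * b) := fun t => by
      have hpt : ∀ s, (t * |√(g s) - √(q s)| + (√(g s) + √(q s))) ^ 2 =
          (t ^ 2 + 1) * (g s + q s) + (2 * t) * |g s - q s|
            + (2 - 2 * t ^ 2) * (√(g s) * √(q s)) := fun s => by
        have h1 := Real.sq_sqrt (hg0 s)
        have h2 := Real.sq_sqrt (hq0 s)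
        have h3 : |g s - q s| = |√(g s) - √(q s)| * (√(g s) + √(q s)) := by
          have h5 : g s - q s = (√(g s) - √(q s)) * (√(g s) + √(q s)) := by
            linarith [sq_sub_sq (√(g s)) (√(q s))]
          rw [h5, abs_mul, abs_of_nonneg (show 0 ≤ √(g s) + √(q s) by positivity)]
        have h4 := sq_abs (√(g s) - √(q s))
        rw [h3]
        nlinarith
      have h : ∫ s, (t * |√(g s) - √(q s)| + (√(g s) + √(q s))) ^ 2 ∂ν =
          (t ^ 2 + 1) * 2 + 2 * t * X + (2 - 2 * t ^ 2) * b := by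
        simp_rw [hpt]
        have i1 : Integrable (fun s => (t ^ 2 + 1) * (g s + q s)) ν := (ig.add iq).const_mul _
        have i2 : Integrable (fun s => (t ^ 2 + 1) * (g s + q s) + 2 * t * |g s - q s|) ν :=
          i1.add (iX.const_mul _)
        rw [integral_add i2 (igq.const_mul _), integral_add i1 (iX.const_mul _), integral_const_mul,
          integral_const_mul, integral_const_mul, integral_add ig iq, hg1, hq1, hbq, ← hX]
        ring
      have h' : 0 ≤ ∫ s, (t * |√(g s) - √(q s)| + (√(g s) + √(q s))) ^ 2 ∂ν :=
        integral_nonneg fun s => sq_nonneg _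
      rw [h] at h'
      linarith
    have hd := discrim_le_zero key
    rw [discrim] at hd
    rw [hbe]
    have hZ2 := Real.sq_sqrt hZ0
    change X ^ 2 ≤ _
    nlinarith [sq_nonneg (√Z - b)]

/-- The expected root likelihood ratio of a label is below `1` by a multiple of the squared
`L¹` error of the normalized candidate. -/
theorem integral_sqrtRatio_add_le (hg : Measurable g) (hw : Measurable w)
    (hg0 : ∀ s, 0 ≤ g s) (hw0 : ∀ s, 0 ≤ w s) (hgB : ∀ s, g s ≤ B) (hwB : ∀ s, w s ≤ B)
    (hg1 : ∫ s, g s ∂ν = 1) :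
    Integrable (fun s => (g s * sqrtRatio (g s) (w s) true + sqrtRatio (g s) (w s) false) / 2) ν ∧
    (∫ s, (g s * sqrtRatio (g s) (w s) true + sqrtRatio (g s) (w s) false) / 2 ∂ν)
      + (∫ s, |g s - (∫ t, w t ∂ν)⁻¹ * w s| ∂ν) ^ 2 / (32 * B ^ 2) ≤ 1 := by
  have ig : Integrable g ν := integrable_of_nonneg_of_le hg hg0 hgB
  have hB1 : 1 ≤ B := by
    calc (1 : ℝ) = ∫ s, g s ∂ν := hg1.symm
      _ ≤ ∫ _, B ∂ν := integral_mono ig (integrable_const _) hgB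
      _ = B := by simp
  have hpt := fun s => sqrtRatio_add_sq_le (hg0 s) (hw0 s) (hwB s)
  have hsq0 : ∀ s, 0 ≤ (√(g s) - √(w s)) ^ 2 / (4 * (1 + B)) := fun s => by positivity
  have hr0 : ∀ s, 0 ≤ (g s * sqrtRatio (g s) (w s) true + sqrtRatio (g s) (w s) false) / 2 :=
    fun s => by
      have := sqrtRatio_nonneg (g s) (w s) true
      have := sqrtRatio_nonneg (g s) (w s) false
      have := hg0 s
      positivity
  have hm : ∀ y, Measurable fun s => sqrtRatio (g s) (w s) y := fun y =>
    (measurable_sqrtRatio y).comp (hg.prodMk hw)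
  have ir : Integrable
      (fun s => (g s * sqrtRatio (g s) (w s) true + sqrtRatio (g s) (w s) false) / 2) ν :=
    integrable_of_nonneg_of_le (c := (1 + B) / 2)
      (((hg.mul (hm true)).add (hm false)).div_const 2) hr0
      fun s => by have := hpt s; have := hsq0 s; have := hgB s; linarith
  have is : Integrable (fun s => (√(g s) - √(w s)) ^ 2 / (4 * (1 + B))) ν :=
    integrable_of_nonneg_of_le (c := (1 + B) / 2) (by fun_prop) hsq0
      fun s => by have := hpt s; have := hr0 s; have := hgB s; linarith
  refine ⟨ir, ?_⟩
  have i1 : Integrable (fun s => (1 + g s) / 2) ν :=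
    ((integrable_const (1 : ℝ)).add ig).div_const 2
  have h1 : ∫ s, _ ∂ν ≤ ∫ s, _ ∂ν := integral_mono (ir.add is) i1 hpt
  simp only [Pi.add_apply] at h1
  rw [integral_add ir is, integral_div _ fun s => (√(g s) - √(w s)) ^ 2,
    integral_div _ fun s => 1 + g s, integral_add (integrable_const _) ig,
    hg1] at h1
  simp only [integral_const, probReal_univ, smul_eq_mul, mul_one] at h1
  have h2 := sq_integral_abs_sub_normalized_le hg hw hg0 hw0 hgB hwB hg1
  set X := ∫ s, |g s - (∫ t, w t ∂ν)⁻¹ * w s| ∂ν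
  set K := ∫ s, (√(g s) - √(w s)) ^ 2 ∂ν
  have hK : 0 ≤ K := integral_nonneg fun s => sq_nonneg _
  have h3 : X ^ 2 / (32 * B ^ 2) ≤ K / (4 * (1 + B)) := by
    rw [div_le_div_iff₀ (by positivity) (by positivity)]
    nlinarith [mul_le_mul_of_nonneg_right h2 (show 0 ≤ 4 * (1 + B) by positivity),
      mul_nonneg hK (show 0 ≤ (2 * B + 1) * (B - 1) by nlinarith)]
  linarith

end Hellinger

end ContrastiveRL

/-! ### Sampling kernels and their means -/

namespace ContrastiveRL

variable {S A T : Type*} [MeasurableSpace S] [MeasurableSpace A] [MeasurableSpace T]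

instance (B : Type*) [MeasurableSpace B] [Fintype B] [Nonempty B] :
    IsProbabilityMeasure (unif B) := by
  unfold unif; infer_instance

instance : IsProbabilityMeasure coin := by unfold coin; infer_instance

theorem lintegral_coin (f : Bool → ℝ≥0∞) : ∫⁻ y, f y ∂coin = (f true + f false) / 2 := by
  have h : ∀ y, coin {y} = 2⁻¹ := fun y => by
    simp [coin, unif]
  rw [lintegral_fintype]
  simp only [h, Fintype.sum_bool]
  rw [div_eq_mul_inv, add_mul]

theorem lintegral_prod_coin {X Y : Type*} [MeasurableSpace X] [MeasurableSpace Y] (μ : Measure X)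
    [SFinite μ] (ν : Measure Y) [SFinite ν] {f : X × (Bool × Y) → ℝ≥0∞} (hf : Measurable f) :
    ∫⁻ p, f p ∂μ.prod (coin.prod ν) =
      (∫⁻ x, ∫⁻ n, f (x, true, n) ∂ν ∂μ + ∫⁻ x, ∫⁻ n, f (x, false, n) ∂ν ∂μ) / 2 := by
  have h1 : ∀ x y, Measurable fun n => f (x, y, n) := fun x y => by fun_prop
  have h2 : ∀ y, Measurable fun x => ∫⁻ n, f (x, y, n) ∂ν := fun y =>
    Measurable.lintegral_prod_right' (f := fun p : X × Y => f (p.1, y, p.2)) (by fun_prop)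
  rw [lintegral_prod _ hf.aemeasurable]
  have : ∀ x, ∫⁻ q, f (x, q) ∂coin.prod ν =
      (∫⁻ n, f (x, true, n) ∂ν + ∫⁻ n, f (x, false, n) ∂ν) / 2 := fun x => by
    rw [lintegral_prod (fun q => f (x, q)) (by fun_prop), lintegral_coin]
  simp_rw [this, div_eq_mul_inv]
  have h3 : Measurable fun x => ∫⁻ n, f (x, true, n) ∂ν + ∫⁻ n, f (x, false, n) ∂ν :=
    (h2 true).add (h2 false)
  rw [lintegral_mul_const _ h3, lintegral_add_left (h2 true)]

theorem measurable_select {Ω X Y : Type*} [MeasurableSpace Ω] [MeasurableSpace X]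
    [MeasurableSpace Y] {b : Ω → Bool} {x y : Ω → X} {c : Ω → Y} (hb : Measurable b)
    (hx : Measurable x) (hy : Measurable y) (hc : Measurable c) :
    Measurable fun p => (c p, (if b p then x p else y p), b p) :=
  hc.prodMk ((Measurable.ite (hb (measurableSet_singleton true)) hx hy).prodMk hb)

theorem measurable_stepMap : Measurable
    fun p : (S × A) × (((S × A) × S) × (Bool × (S × S))) =>
      (((p.1, (if p.2.2.1 then p.2.1.1.1 else p.2.2.2.1), p.2.2.1),
        (p.2.1.1, (if p.2.2.1 then p.2.1.2 else p.2.2.2.2), p.2.2.1)) :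
          Sample S A × Sample S A) :=
  (measurable_select (by fun_prop) (by fun_prop) (by fun_prop) (by fun_prop)).prodMk
    (measurable_select (by fun_prop) (by fun_prop) (by fun_prop) (by fun_prop))

theorem measurable_lastMap : Measurable
    fun p : (S × A) × (S × (Bool × S)) =>
      ((p.1, (if p.2.2.1 then p.2.1 else p.2.2.2), p.2.2.1) : Sample S A) :=
  measurable_select (by fun_prop) (by fun_prop) (by fun_prop) (by fun_prop)

namespace MDP

variable (M : MDP S A) {h : ℕ}

theorem trans_apply (hh : h ∈ Finset.Icc 1 M.H) (z : S × A) :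
    M.trans h z = M.vol.withDensity fun s' => ENNReal.ofReal (M.P h z s') := by
  have hm : Measurable (Function.uncurry fun z s' => ENNReal.ofReal (M.P h z s')) :=
    (M.P_measurable h hh).ennreal_ofReal
  rw [trans, Kernel.withDensity_apply _ hm, Kernel.const_apply]

theorem isMarkovKernel_trans (hh : h ∈ Finset.Icc 1 M.H) : IsMarkovKernel (M.trans h) :=
  ⟨fun z => ⟨by
    rw [M.trans_apply hh, withDensity_apply _ .univ, Measure.restrict_univ, M.P_density h hh]⟩⟩

variable {M} in
theorem IsNegativeDensity.isProbabilityMeasure {neg : S → ℝ} {C : ℝ}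
    (hneg : M.IsNegativeDensity neg C) : IsProbabilityMeasure (M.negMeasure neg) :=
  ⟨by rw [negMeasure, withDensity_apply _ .univ, Measure.restrict_univ, hneg.density]⟩

theorem isMarkovKernel_stateLaw (π : ℕ → Kernel (T × S) A) [∀ h, IsMarkovKernel (π h)] {n : ℕ}
    (hn : n ≤ M.H) : IsMarkovKernel (M.stateLaw π n) := by
  induction n with
  | zero => unfold stateLaw; infer_instance
  | succ n ih =>
    have := ih (by omega)
    have := M.isMarkovKernel_trans (h := n + 1) (by simp; omega)
    unfold stateLaw; infer_instance

/-- The mean of `w` over a labelled transition at step `h` that starts at `z`. -/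
noncomputable def labelledMean (neg : S → ℝ) (h : ℕ) (w : Sample S A → ℝ≥0∞) (z : S × A) : ℝ≥0∞ :=
  (∫⁻ s, w (z, s, true) ∂M.trans h z + ∫⁻ s, w (z, s, false) ∂M.negMeasure neg) / 2

variable {neg : S → ℝ} {C : ℝ} {w : Sample S A → ℝ≥0∞}

theorem measurable_labelledMean (hneg : M.IsNegativeDensity neg C) (hh : h ∈ Finset.Icc 1 M.H)
    (hw : Measurable w) : Measurable (M.labelledMean neg h w) := by
  have := M.isMarkovKernel_trans hh
  have := hneg.isProbabilityMeasure
  refine (Measurable.add ?_ ?_).div_const 2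
  · exact Measurable.lintegral_kernel_prod_right (κ := M.trans h)
      (f := fun z s => w (z, s, true)) (by unfold Function.uncurry; fun_prop)
  · exact Measurable.lintegral_prod_right' (ν := M.negMeasure neg)
      (f := fun p : (S × A) × S => w (p.1, p.2, false)) (by fun_prop)

theorem isMarkovKernel_lastKernel (hneg : M.IsNegativeDensity neg C) :
    IsMarkovKernel (M.lastKernel neg) := by
  have := M.isMarkovKernel_trans (h := M.H) (by simp [M.H_pos])
  have := hneg.isProbabilityMeasure
  exact Kernel.IsMarkovKernel.map _ measurable_lastMap

theorem lintegral_lastKernel (hneg : M.IsNegativeDensity neg C) (hw : Measurable w) (z : S × A) :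
    ∫⁻ x, w x ∂M.lastKernel neg z = M.labelledMean neg M.H w z := by
  have := M.isMarkovKernel_trans (h := M.H) (by simp [M.H_pos])
  have := hneg.isProbabilityMeasure
  have hm := hw.comp (measurable_lastMap (S := S) (A := A))
  have hm' := hm.comp (measurable_prodMk_left (x := z))
  rw [lastKernel, Kernel.lintegral_map _ measurable_lastMap _ hw]
  refine (Kernel.lintegral_id_prod hm _ _).trans ?_
  rw [Kernel.prod_apply, Kernel.const_apply]
  refine (lintegral_prod_coin _ _ hm').trans ?_
  simp [labelledMean]

variable [Fintype A] [Nonempty A]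

theorem isMarkovKernel_dTilde (π : ℕ → Kernel (T × S) A) [∀ h, IsMarkovKernel (π h)]
    (hh : h ≤ M.H) : IsMarkovKernel (M.dTilde π h) := by
  have := M.isMarkovKernel_stateLaw π (n := h - 1) (by omega)
  unfold dTilde stateDist; infer_instance

theorem isMarkovKernel_dBreve (π : ℕ → Kernel (T × S) A) [∀ h, IsMarkovKernel (π h)]
    (hh : h ∈ Finset.Icc 2 M.H) : IsMarkovKernel (M.dBreve π h) := by
  rw [Finset.mem_Icc] at hh
  have := M.isMarkovKernel_dTilde π (h := h - 1) (by omega)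
  have := M.isMarkovKernel_trans (h := h - 1) (by simp; omega)
  unfold dBreve; infer_instance

theorem isMarkovKernel_stepKernel (hneg : M.IsNegativeDensity neg C)
    (hh : h ∈ Finset.Icc 1 (M.H - 1)) : IsMarkovKernel (M.stepKernel neg h) := by
  rw [Finset.mem_Icc] at hh
  have := M.isMarkovKernel_trans (h := h) (by simp; omega)
  have := M.isMarkovKernel_trans (h := h + 1) (by simp; omega)
  have := hneg.isProbabilityMeasure
  exact Kernel.IsMarkovKernel.map _ measurable_stepMap

theorem lintegral_stepKernel_fst (hneg : M.IsNegativeDensity neg C)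
    (hh : h ∈ Finset.Icc 1 (M.H - 1)) (hw : Measurable w) (z : S × A) :
    ∫⁻ p, w p.1 ∂M.stepKernel neg h z = M.labelledMean neg h w z := by
  rw [Finset.mem_Icc] at hh
  have := M.isMarkovKernel_trans (h := h) (by simp; omega)
  have := M.isMarkovKernel_trans (h := h + 1) (by simp; omega)
  have := hneg.isProbabilityMeasure
  have hw1 := hw.comp (measurable_fst : Measurable (Prod.fst : Sample S A × Sample S A → _))
  have hm := hw1.comp (measurable_stepMap (S := S) (A := A))
  have hm' := hm.comp (measurable_prodMk_left (x := z))
  rw [stepKernel]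
  refine (Kernel.lintegral_map _ measurable_stepMap _ hw1).trans ?_
  refine (Kernel.lintegral_id_prod hm _ _).trans ?_
  rw [Kernel.prod_apply, Kernel.const_apply]
  refine (lintegral_prod_coin _ _ hm').trans ?_
  simp only [Function.comp_apply, if_true, Bool.false_eq_true, if_false, lintegral_const,
    measure_univ, mul_one, labelledMean]
  congr 2
  · rw [Kernel.lintegral_compProd _ _ _ (by fun_prop)]
    simp only [lintegral_const, measure_univ, mul_one]
    rw [Kernel.prod_apply, lintegral_prod _ (by fun_prop)]
    simp
  · rw [lintegral_prod _ (by fun_prop)]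
    simp

/-- Given the first transition, the continued sample is a labelled transition at step `h + 1` that
starts at the next state and a uniform action: the shared label is independent of both. -/
theorem lintegral_stepKernel_snd (hneg : M.IsNegativeDensity neg C)
    (hh : h ∈ Finset.Icc 1 (M.H - 1)) (hw : Measurable w) (z : S × A) :
    ∫⁻ p, w p.2 ∂M.stepKernel neg h z =
      ∫⁻ z', M.labelledMean neg (h + 1) w z' ∂(M.trans h z).prod (unif A) := by
  rw [Finset.mem_Icc] at hh
  have := M.isMarkovKernel_trans (h := h) (by simp; omega)
  have := M.isMarkovKernel_trans (h := h + 1) (by simp; omega)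
  have := hneg.isProbabilityMeasure
  have hw2 := hw.comp (measurable_snd : Measurable (Prod.snd : Sample S A × Sample S A → _))
  have hm := hw2.comp (measurable_stepMap (S := S) (A := A))
  have hm' := hm.comp (measurable_prodMk_left (x := z))
  rw [stepKernel]
  refine (Kernel.lintegral_map _ measurable_stepMap _ hw2).trans ?_
  refine (Kernel.lintegral_id_prod hm _ _).trans ?_
  rw [Kernel.prod_apply, Kernel.const_apply]
  refine (lintegral_prod_coin _ _ hm').trans ?_
  have hn : Measurable fun z' : S × A => ∫⁻ s, w (z', s, false) ∂M.negMeasure neg :=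
    Measurable.lintegral_prod_right' (ν := M.negMeasure neg)
      (f := fun p : (S × A) × S => w (p.1, p.2, false)) (by fun_prop)
  have hp : Measurable fun z' : S × A => ∫⁻ s, w (z', s, true) ∂M.trans (h + 1) z' :=
    Measurable.lintegral_kernel_prod_right (κ := M.trans (h + 1))
      (f := fun z s => w (z, s, true)) (by unfold Function.uncurry; fun_prop)
  have e : ∀ z' : S × A, ∫⁻ n : S × S, w (z', n.2, false)
      ∂(M.negMeasure neg).prod (M.negMeasure neg) = ∫⁻ s, w (z', s, false) ∂M.negMeasure neg :=
    fun z' => by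
      rw [lintegral_prod _ (by fun_prop)]
      simp
  simp only [Function.comp_apply, if_true, Bool.false_eq_true, if_false, lintegral_const,
    measure_univ, mul_one, labelledMean, e]
  rw [Kernel.lintegral_compProd _ _ _ (by fun_prop), Kernel.lintegral_compProd _ _ _ (by fun_prop)]
  simp only [lintegral_const, measure_univ, mul_one, Kernel.prod_apply, Kernel.const_apply,
    Kernel.prodMkLeft_apply, div_eq_mul_inv]
  have hpn : Measurable fun z' : S × A => ∫⁻ s, w (z', s, true) ∂M.trans (h + 1) z'
      + ∫⁻ s, w (z', s, false) ∂M.negMeasure neg := hp.add hn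
  rw [lintegral_mul_const _ hpn, lintegral_add_left hp]

theorem lintegral_step_dTilde_fst (hneg : M.IsNegativeDensity neg C)
    (π : ℕ → Kernel (T × S) A) [∀ h, IsMarkovKernel (π h)]
    (hh : h ∈ Finset.Icc 1 (M.H - 1)) (hw : Measurable w) (t : T) :
    ∫⁻ p, w p.1 ∂(M.stepKernel neg h ∘ₖ M.dTilde π h) t =
      ∫⁻ z, M.labelledMean neg h w z ∂M.dTilde π h t := by
  rw [Kernel.lintegral_comp _ _ _ (by fun_prop)]
  simp_rw [M.lintegral_stepKernel_fst hneg hh hw]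

theorem lintegral_step_dTilde_snd (hneg : M.IsNegativeDensity neg C)
    (π : ℕ → Kernel (T × S) A) [∀ h, IsMarkovKernel (π h)]
    (hh : h ∈ Finset.Icc 1 (M.H - 1)) (hw : Measurable w) (t : T) :
    ∫⁻ p, w p.2 ∂(M.stepKernel neg h ∘ₖ M.dTilde π h) t =
      ∫⁻ z, M.labelledMean neg (h + 1) w z ∂M.dBreve π (h + 1) t := by
  have hh' := Finset.mem_Icc.1 hh
  have := M.isMarkovKernel_dTilde π (h := h) (by omega)
  have := M.isMarkovKernel_trans (h := h) (by simp; omega)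
  have hl := M.measurable_labelledMean hneg (h := h + 1) (by simp; omega) hw
  have hi : Measurable fun s => ∫⁻ a, M.labelledMean neg (h + 1) w (s, a) ∂unif A :=
    hl.lintegral_prod_right'
  rw [Kernel.lintegral_comp _ _ _ (by fun_prop)]
  simp_rw [M.lintegral_stepKernel_snd hneg hh hw]
  rw [dBreve, Nat.add_sub_cancel, Kernel.prod_apply, Kernel.const_apply,
    lintegral_prod _ hl.aemeasurable, Kernel.lintegral_comp _ _ _ hi]
  refine lintegral_congr fun z => ?_
  rw [lintegral_prod _ hl.aemeasurable]

end MDP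

theorem measurable_finCons {X : Type*} [MeasurableSpace X] (n : ℕ) :
    Measurable fun p : X × (Fin n → X) => (Fin.cons p.1 p.2 : Fin (n + 1) → X) :=
  measurable_pi_iff.2 fun i => Fin.cases (by simpa using measurable_fst)
    (fun j => by simp only [Fin.cons_succ]; fun_prop) i

theorem isMarkovKernel_piKernel {X : Type*} [MeasurableSpace X] (n : ℕ) (κ : Fin n → Kernel T X)
    [∀ i, IsMarkovKernel (κ i)] : IsMarkovKernel (piKernel n κ) := by
  induction n with
  | zero => unfold piKernel; infer_instance
  | succ n ih =>
    have := ih fun i => κ i.succ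
    exact Kernel.IsMarkovKernel.map _ (measurable_finCons n)

theorem lintegral_prod_piKernel {X : Type*} [MeasurableSpace X] (n : ℕ) (κ : Fin n → Kernel T X)
    [∀ i, IsMarkovKernel (κ i)] (f : Fin n → X → ℝ≥0∞) (hf : ∀ i, Measurable (f i)) (t : T) :
    ∫⁻ x, ∏ i, f i (x i) ∂piKernel n κ t = ∏ i, ∫⁻ x, f i x ∂κ i t := by
  induction n with
  | zero => simp [piKernel]
  | succ n ih =>
    have := isMarkovKernel_piKernel n fun i => κ i.succ
    have hp : Measurable fun x : Fin n → X => ∏ i, f i.succ (x i) :=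
      Finset.measurable_fun_prod _ fun i _ => (hf i.succ).comp (measurable_pi_apply i)
    have hp' : Measurable fun x : Fin (n + 1) → X => ∏ i, f i (x i) :=
      Finset.measurable_fun_prod _ fun i _ => (hf i).comp (measurable_pi_apply i)
    rw [piKernel, Kernel.lintegral_map _ (measurable_finCons n) _ hp']
    simp only [Fin.prod_univ_succ, Fin.cons_zero, Fin.cons_succ]
    rw [Kernel.prod_apply, lintegral_prod_mul (hf 0).aemeasurable hp.aemeasurable,
      ih (fun i => κ i.succ) (fun i => f i.succ) fun i => hf i.succ]

end ContrastiveRL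

/-! ### One round of data and the exponential supermartingale -/

namespace ContrastiveRL

section Data

variable {S A : Type*}

theorem prod_ite_add_eq {n : ℕ} (c h : ℕ) (f : Fin n → ℝ≥0∞) :
    (∏ i : Fin n, if (i : ℕ) + c = h then f i else 1) =
      if hh : c ≤ h ∧ h - c < n then f ⟨h - c, hh.2⟩ else 1 := by
  split_ifs with hh
  · rw [Finset.prod_eq_single (⟨h - c, hh.2⟩ : Fin n)]
    · rw [if_pos (Nat.sub_add_cancel hh.1)]
    · intro i _ hi
      rw [if_neg]
      rintro rfl
      exact hi (Fin.ext (by simp))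
    · simp
  · refine Finset.prod_eq_one fun i _ => if_neg ?_
    rintro rfl
    exact hh ⟨by omega, by simp⟩

/-- The product over the data of one round as a product over its independent iterations: the sample
from `d̃_h` sits at index `h - 1`, or in the last iteration if `h = H`, the one from `d̆_h` at
`h - 2`. -/
theorem prod_map_roundData {H : ℕ} (R : Round S A H) {h : ℕ} (hh : h ∈ Finset.Icc 1 H)
    (w : Sample S A → ℝ≥0∞) :
    ((roundData R h).map w).prod =
      (∏ i : Fin (H - 1), (if (i : ℕ) + 1 = h then w (R.1 i).1 else 1) *
        (if (i : ℕ) + 2 = h then w (R.1 i).2 else 1)) * (if h = H then w R.2 else 1) := by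
  rw [Finset.mem_Icc] at hh
  rw [Finset.prod_mul_distrib, prod_ite_add_eq 1 h fun i => w (R.1 i).1,
    prod_ite_add_eq 2 h fun i => w (R.1 i).2, roundData, Multiset.map_add, Multiset.prod_add]
  have e1 : ((({tildeSample R h} : Multiset (Sample S A))).map w).prod =
      (if hh : 1 ≤ h ∧ h - 1 < H - 1 then w (R.1 ⟨h - 1, hh.2⟩).1 else 1) *
        (if h = H then w R.2 else 1) := by
    rw [Multiset.map_singleton, Multiset.prod_singleton, tildeSample]
    by_cases h1 : h - 1 < H - 1
    · rw [dif_pos h1, dif_pos ⟨hh.1, h1⟩, if_neg (by omega), mul_one]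
    · rw [dif_neg h1, dif_neg (by omega), if_pos (by omega), one_mul]
  have e2 : ((if hh : 2 ≤ h ∧ h ≤ H then ({(R.1 ⟨h - 2, by omega⟩).2} : Multiset (Sample S A))
      else 0).map w).prod =
      if hh : 2 ≤ h ∧ h - 2 < H - 1 then w (R.1 ⟨h - 2, hh.2⟩).2 else 1 := by
    by_cases h2 : 2 ≤ h
    · rw [dif_pos ⟨h2, hh.2⟩, dif_pos ⟨h2, by omega⟩, Multiset.map_singleton,
        Multiset.prod_singleton]
    · rw [dif_neg (by omega), dif_neg (by omega), Multiset.map_zero, Multiset.prod_zero]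
  rw [e1, e2]
  ring

theorem prod_map_dataset {H k : ℕ} (D : History S A H k) (h : ℕ) (w : Sample S A → ℝ≥0∞) :
    ((dataset D h).map w).prod = ∏ j, ((roundData (D j) h).map w).prod := by
  rw [dataset, ← Multiset.coe_mapAddMonoidHom, map_sum, Multiset.prod_sum]

theorem take_snoc_castSucc {H k : ℕ} (D : History S A H k) (R : Round S A H) (j : Fin k) :
    History.take (Fin.snoc D R : History S A H (k + 1)) j.castSucc = History.take D j := by
  funext i
  exact Fin.snoc_castSucc (α := fun _ => Round S A H) R D (Fin.castLE j.isLt.le i)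

theorem take_snoc_last {H k : ℕ} (D : History S A H k) (R : Round S A H) :
    History.take (Fin.snoc D R : History S A H (k + 1)) (Fin.last k) = D := by
  funext i
  exact Fin.snoc_castSucc (α := fun _ => Round S A H) R D i

end Data

variable {S A T : Type*} [MeasurableSpace S] [MeasurableSpace A] [MeasurableSpace T]

theorem measurable_finSnoc {X : Type*} [MeasurableSpace X] (n : ℕ) :
    Measurable fun p : (Fin n → X) × X => (Fin.snoc p.1 p.2 : Fin (n + 1) → X) :=
  measurable_pi_iff.2 fun i => Fin.lastCases (by simpa using measurable_snd)
    (fun j => by simp only [Fin.snoc_castSucc]; fun_prop) i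

theorem measurable_take {H k : ℕ} (j : Fin k) :
    Measurable fun D : History S A H k => History.take D j :=
  measurable_pi_iff.2 fun _ => measurable_pi_apply _

theorem _root_.Measurable.ite_one {X : Type*} [MeasurableSpace X] {f : X → ℝ≥0∞}
    (hf : Measurable f) (p : Prop) [Decidable p] : Measurable fun x => if p then f x else 1 := by
  by_cases hp : p
  · simpa only [if_pos hp] using hf
  · simpa only [if_neg hp] using measurable_const

theorem measurable_prod_map_roundData {H : ℕ} {h : ℕ} (hh : h ∈ Finset.Icc 1 H)
    {w : Sample S A → ℝ≥0∞} (hw : Measurable w) :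
    Measurable fun R : Round S A H => ((roundData R h).map w).prod := by
  simp_rw [prod_map_roundData _ hh]
  exact (Finset.measurable_fun_prod _ fun i _ =>
    ((hw.comp (measurable_fst.comp ((measurable_pi_apply i).comp measurable_fst))).ite_one _).mul
      ((hw.comp (measurable_snd.comp ((measurable_pi_apply i).comp measurable_fst))).ite_one _)).mul
    ((hw.comp measurable_snd).ite_one _)

variable [Fintype A] [Nonempty A]

namespace MDP

variable (M : MDP S A) {h : ℕ} {neg : S → ℝ} {C : ℝ} {w : Sample S A → ℝ≥0∞}

theorem isMarkovKernel_step_dTilde (hneg : M.IsNegativeDensity neg C)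
    (π : ℕ → Kernel (T × S) A) [∀ h, IsMarkovKernel (π h)] (i : Fin (M.H - 1)) :
    IsMarkovKernel (M.stepKernel neg (i + 1) ∘ₖ M.dTilde π (i + 1)) := by
  have := M.isMarkovKernel_stepKernel hneg (h := i + 1) (by simp)
  have := M.isMarkovKernel_dTilde π (h := i + 1) (by omega)
  infer_instance

theorem isMarkovKernel_last_dTilde (hneg : M.IsNegativeDensity neg C)
    (π : ℕ → Kernel (T × S) A) [∀ h, IsMarkovKernel (π h)] :
    IsMarkovKernel (M.lastKernel neg ∘ₖ M.dTilde π M.H) := by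
  have := M.isMarkovKernel_lastKernel hneg
  have := M.isMarkovKernel_dTilde π le_rfl
  infer_instance

theorem isMarkovKernel_roundKernel (hneg : M.IsNegativeDensity neg C)
    (π : ℕ → Kernel (T × S) A) [∀ h, IsMarkovKernel (π h)] :
    IsMarkovKernel (M.roundKernel neg π) := by
  have := M.isMarkovKernel_step_dTilde hneg π
  have := M.isMarkovKernel_last_dTilde hneg π
  have := isMarkovKernel_piKernel (M.H - 1) fun i : Fin (M.H - 1) =>
    M.stepKernel neg (i + 1) ∘ₖ M.dTilde π (i + 1)
  unfold roundKernel; infer_instance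

/-- The two samples that one round adds to the data set of step `h` are independent given the past,
because they come from different iterations of the round. -/
theorem lintegral_prod_map_roundData (hneg : M.IsNegativeDensity neg C)
    (π : ℕ → Kernel (T × S) A) [∀ h, IsMarkovKernel (π h)]
    (hh : h ∈ Finset.Icc 1 M.H) (hw : Measurable w) (t : T) :
    ∫⁻ R, ((roundData R h).map w).prod ∂M.roundKernel neg π t =
      (∫⁻ z, M.labelledMean neg h w z ∂M.dTilde π h t) *
        (if 2 ≤ h then ∫⁻ z, M.labelledMean neg h w z ∂M.dBreve π h t else 1) := by
  have := M.isMarkovKernel_step_dTilde hneg π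
  have := M.isMarkovKernel_last_dTilde hneg π
  have := isMarkovKernel_piKernel (M.H - 1) fun i : Fin (M.H - 1) =>
    M.stepKernel neg (i + 1) ∘ₖ M.dTilde π (i + 1)
  have hf : ∀ i : Fin (M.H - 1), Measurable fun p : Sample S A × Sample S A =>
      (if (i : ℕ) + 1 = h then w p.1 else 1) * (if (i : ℕ) + 2 = h then w p.2 else 1) :=
    fun i => ((hw.comp measurable_fst).ite_one _).mul ((hw.comp measurable_snd).ite_one _)
  have hf' : Measurable fun x : Fin (M.H - 1) → Sample S A × Sample S A =>
      ∏ i : Fin (M.H - 1), (if (i : ℕ) + 1 = h then w (x i).1 else 1) *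
        (if (i : ℕ) + 2 = h then w (x i).2 else 1) :=
    Finset.measurable_fun_prod _ fun i _ => (hf i).comp (measurable_pi_apply i)
  have hl : Measurable fun x : Sample S A => if h = M.H then w x else 1 :=
    hw.ite_one _
  have e1 : ∀ i : Fin (M.H - 1),
      ∫⁻ p, (if (i : ℕ) + 1 = h then w p.1 else 1) * (if (i : ℕ) + 2 = h then w p.2 else 1)
        ∂(M.stepKernel neg (i + 1) ∘ₖ M.dTilde π (i + 1)) t =
      (if (i : ℕ) + 1 = h then ∫⁻ z, M.labelledMean neg h w z ∂M.dTilde π h t else 1) *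
        (if (i : ℕ) + 2 = h then ∫⁻ z, M.labelledMean neg h w z ∂M.dBreve π h t else 1) := by
    intro i
    by_cases h1 : (i : ℕ) + 1 = h
    · have h2 : ¬(i : ℕ) + 2 = h := by omega
      simp only [if_neg h2, if_pos h1, mul_one]
      rw [M.lintegral_step_dTilde_fst hneg π (by simp) hw, h1]
    · by_cases h2 : (i : ℕ) + 2 = h
      · simp only [if_pos h2, if_neg h1, one_mul]
        rw [M.lintegral_step_dTilde_snd hneg π (by simp) hw, ← h2]
      · simp only [if_neg h2, if_neg h1, one_mul, lintegral_one, measure_univ]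
  have e2 : ∫⁻ x, (if h = M.H then w x else 1) ∂(M.lastKernel neg ∘ₖ M.dTilde π M.H) t =
      if h = M.H then ∫⁻ z, M.labelledMean neg h w z ∂M.dTilde π h t else 1 := by
    split_ifs with hH
    · rw [Kernel.lintegral_comp _ _ _ hw]
      simp_rw [M.lintegral_lastKernel hneg hw, hH]
    · simp
  simp_rw [prod_map_roundData _ hh]
  rw [roundKernel, Kernel.prod_apply, lintegral_prod_mul hf'.aemeasurable hl.aemeasurable,
    lintegral_prod_piKernel _ _ _ hf, e2]
  simp_rw [e1]
  rw [Finset.prod_mul_distrib, prod_ite_add_eq, prod_ite_add_eq]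
  rw [Finset.mem_Icc] at hh
  rcases hh.2.eq_or_lt with hH | hH
  · rw [dif_neg (by omega), if_pos hH, one_mul, mul_comm]
    congr 1
    by_cases h2 : 2 ≤ h
    · rw [dif_pos (by omega), if_pos h2]
    · rw [dif_neg (by omega), if_neg h2]
  · rw [dif_pos (by omega), if_neg hH.ne, mul_one]
    congr 1
    by_cases h2 : 2 ≤ h
    · rw [dif_pos (by omega), if_pos h2]
    · rw [dif_neg (by omega), if_neg h2]

end MDP

theorem mul_ofReal_exp_le_one {a x : ℝ≥0∞} (h : a + x ≤ 1) :
    a * ENNReal.ofReal (Real.exp x.toReal) ≤ 1 := by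
  have hx : x ≠ ⊤ := ne_top_of_le_ne_top ENNReal.one_ne_top (le_add_self.trans h)
  have ha : a ≠ ⊤ := ne_top_of_le_ne_top ENNReal.one_ne_top (le_self_add.trans h)
  lift x to NNReal using hx
  lift a to NNReal using ha
  have h' : (a : ℝ) + x ≤ 1 := by exact_mod_cast h
  rw [← ENNReal.ofReal_coe_nnreal (p := a), ← ENNReal.ofReal_mul a.coe_nonneg, ← ENNReal.ofReal_one,
    ENNReal.coe_toReal]
  refine ENNReal.ofReal_le_ofReal ?_
  calc (a : ℝ) * Real.exp x ≤ Real.exp (-x) * Real.exp x := by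
        gcongr
        linarith [Real.one_sub_le_exp_neg (x : ℝ)]
    _ = 1 := by rw [← Real.exp_add]; simp

namespace ContrastiveUCB

variable {M : MDP S A} {d : ℕ} {neg : S → ℝ} {Ψ : Finset (S → Feat d)}
  {Φ : Finset (S × A → Feat d)} {lam gam : ℕ → ℝ} {C : ℝ} {h : ℕ}
  (alg : ContrastiveUCB M neg Ψ Φ lam gam)

instance (k h : ℕ) : IsMarkovKernel (alg.policy k h) := by
  unfold policy; split_ifs <;> infer_instance

theorem isProbabilityMeasure_historyLaw (hneg : M.IsNegativeDensity neg C) (k : ℕ) :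
    IsProbabilityMeasure (alg.historyLaw k) := by
  induction k with
  | zero => unfold historyLaw; infer_instance
  | succ k ih =>
    have := M.isMarkovKernel_roundKernel hneg (alg.policy k)
    exact Measure.isProbabilityMeasure_map (measurable_finSnoc k).aemeasurable

/-- Weights whose conditional mean given the past is at most one multiply up to a weight of mean at
most one. -/
theorem lintegral_prod_historyLaw_le (hneg : M.IsNegativeDensity neg C)
    (W : (j : ℕ) → History S A M.H j × Round S A M.H → ℝ≥0∞) (hW : ∀ j, Measurable (W j))
    (hW1 : ∀ j D, ∫⁻ R, W j (D, R) ∂M.roundKernel neg (alg.policy j) D ≤ 1) (k : ℕ) :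
    ∫⁻ D, ∏ j : Fin k, W j (History.take D j, D j) ∂alg.historyLaw k ≤ 1 := by
  have hm : ∀ k, Measurable fun D : History S A M.H k =>
      ∏ j : Fin k, W j (History.take D j, D j) := fun k =>
    Finset.measurable_fun_prod _ fun j _ =>
      (hW j).comp ((measurable_take j).prodMk (measurable_pi_apply j))
  induction k with
  | zero => simp [historyLaw]
  | succ k ih =>
    have := M.isMarkovKernel_roundKernel hneg (alg.policy k)
    have := alg.isProbabilityMeasure_historyLaw hneg k
    rw [historyLaw, lintegral_map (hm (k + 1)) (measurable_finSnoc k),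
      Measure.lintegral_compProd (f := fun p => ∏ j : Fin (k + 1),
        W j (History.take (Fin.snoc p.1 p.2 : History S A M.H (k + 1)) j,
          (Fin.snoc p.1 p.2 : History S A M.H (k + 1)) j))
        ((hm (k + 1)).comp (measurable_finSnoc k))]
    refine le_trans (lintegral_mono fun D => ?_) ih
    have e : ∀ R : Round S A M.H, (∏ j : Fin (k + 1),
        W j (History.take (Fin.snoc D R : History S A M.H (k + 1)) j,
          (Fin.snoc D R : History S A M.H (k + 1)) j)) =
        (∏ j : Fin k, W j (History.take D j, D j)) * W k (D, R) := fun R => by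
      rw [Fin.prod_univ_castSucc]
      congr 1
      · refine Finset.prod_congr rfl fun j _ => ?_
        rw [take_snoc_castSucc, Fin.snoc_castSucc]
        rfl
      · rw [take_snoc_last, Fin.snoc_last]
        rfl
    simp_rw [e]
    have hWk : Measurable fun R => W k (D, R) := (hW k).comp measurable_prodMk_left
    rw [lintegral_const_mul _ hWk]
    exact mul_le_of_le_one_right' (hW1 k D)

/-- The mean of `e` under the state-action distributions from which round `j + 1` samples at
step `h`. -/
noncomputable def roundCost (h : ℕ) (e : S × A → ℝ≥0∞) (j : ℕ) (D : History S A M.H j) : ℝ≥0∞ :=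
  ∫⁻ z, e z ∂M.dTilde (alg.policy j) h D +
    if 2 ≤ h then ∫⁻ z, e z ∂M.dBreve (alg.policy j) h D else 0

/-- The sum of the costs of the first `k` rounds. -/
noncomputable def totalCost (h : ℕ) (e : S × A → ℝ≥0∞) (k : ℕ) (D : History S A M.H k) : ℝ≥0∞ :=
  ∑ j : Fin k, alg.roundCost h e j (History.take D j)

variable {e : S × A → ℝ≥0∞} {w : Sample S A → ℝ≥0∞}

theorem measurable_roundCost (he : Measurable e) (h j : ℕ) : Measurable (alg.roundCost h e j) := by
  unfold roundCost
  refine Measurable.add (Measurable.lintegral_kernel he) ?_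
  split_ifs
  · exact Measurable.lintegral_kernel he
  · exact measurable_const

theorem roundCost_ne_top (hh : h ∈ Finset.Icc 1 M.H) (he : ∀ z, e z ≤ 1) (j : ℕ)
    (D : History S A M.H j) : alg.roundCost h e j D ≠ ⊤ := by
  rw [Finset.mem_Icc] at hh
  have hfin : ∀ (μ : Measure (S × A)) [IsProbabilityMeasure μ], ∫⁻ z, e z ∂μ ≠ ⊤ := fun μ _ =>
    ne_top_of_le_ne_top ENNReal.one_ne_top ((lintegral_mono he).trans (by simp))
  have := M.isMarkovKernel_dTilde (alg.policy j) hh.2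
  refine ENNReal.add_ne_top.2 ⟨hfin _, ?_⟩
  split_ifs with h2
  · have := M.isMarkovKernel_dBreve (alg.policy j) (h := h) (by simp; omega)
    exact hfin _
  · exact ENNReal.zero_ne_top

theorem totalCost_ne_top (hh : h ∈ Finset.Icc 1 M.H) (he : ∀ z, e z ≤ 1) (k : ℕ)
    (D : History S A M.H k) : alg.totalCost h e k D ≠ ⊤ :=
  ENNReal.sum_ne_top.2 fun _ _ => alg.roundCost_ne_top hh he _ _

/-- The conditional mean given the past: each factor `a` with `a + x ≤ 1` is compensated by
`exp x`. -/
theorem lintegral_round_weight_le (hneg : M.IsNegativeDensity neg C)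
    (hh : h ∈ Finset.Icc 1 M.H) (hw : Measurable w)
    (hwe : ∀ z, M.labelledMean neg h w z + e z ≤ 1) (j : ℕ) (D : History S A M.H j) :
    ∫⁻ R, ((roundData R h).map w).prod * ENNReal.ofReal (Real.exp (alg.roundCost h e j D).toReal)
      ∂M.roundKernel neg (alg.policy j) D ≤ 1 := by
  have hh' := Finset.mem_Icc.1 hh
  have hL := M.measurable_labelledMean hneg hh hw
  have key : ∀ (μ : Measure (S × A)) [IsProbabilityMeasure μ],
      ∫⁻ z, M.labelledMean neg h w z ∂μ + ∫⁻ z, e z ∂μ ≤ 1 := fun μ _ => by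
    rw [← lintegral_add_left hL]
    exact (lintegral_mono hwe).trans (by simp)
  have he : ∀ z, e z ≤ 1 := fun z => le_add_self.trans (hwe z)
  rw [lintegral_mul_const _ (measurable_prod_map_roundData hh hw),
    M.lintegral_prod_map_roundData hneg _ hh hw]
  have hfin := alg.roundCost_ne_top hh he j D
  have := M.isMarkovKernel_dTilde (alg.policy j) hh'.2
  rw [roundCost, ENNReal.add_ne_top] at hfin
  rw [roundCost, ENNReal.toReal_add hfin.1 hfin.2, Real.exp_add,
    ENNReal.ofReal_mul (Real.exp_pos _).le, mul_mul_mul_comm]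
  refine mul_le_one' (mul_ofReal_exp_le_one (key _)) (mul_ofReal_exp_le_one ?_)
  split_ifs with h2
  · have := M.isMarkovKernel_dBreve (alg.policy j) (h := h) (by simp; omega)
    exact key _
  · simp

/-- The exponential supermartingale bound: if the mean of `w` over a labelled transition from `z`
is at most `1 - e z`, the product of `w` over the data set compensates the exponential of the
accumulated cost. -/
theorem lintegral_prod_dataset_mul_exp_le (hneg : M.IsNegativeDensity neg C)
    (hh : h ∈ Finset.Icc 1 M.H) (hw : Measurable w) (he : Measurable e)
    (hwe : ∀ z, M.labelledMean neg h w z + e z ≤ 1) (k : ℕ) :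
    ∫⁻ D, ((dataset D h).map w).prod * ENNReal.ofReal (Real.exp (alg.totalCost h e k D).toReal)
      ∂alg.historyLaw k ≤ 1 := by
  have he1 : ∀ z, e z ≤ 1 := fun z => le_add_self.trans (hwe z)
  refine le_of_eq_of_le (lintegral_congr fun D => ?_) (alg.lintegral_prod_historyLaw_le hneg
    (fun j p => ((roundData p.2 h).map w).prod *
      ENNReal.ofReal (Real.exp (alg.roundCost h e j p.1).toReal))
    (fun j => ?_) (alg.lintegral_round_weight_le hneg hh hw hwe) k)
  · rw [prod_map_dataset, Finset.prod_mul_distrib, totalCost,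
      ENNReal.toReal_sum fun _ _ => alg.roundCost_ne_top hh he1 _ _, Real.exp_sum,
      ENNReal.ofReal_prod_of_nonneg fun _ _ => (Real.exp_pos _).le]
  · have := alg.measurable_roundCost he h j
    exact ((measurable_prod_map_roundData hh hw).comp measurable_snd).mul (by fun_prop)

/-- Markov's inequality for `lintegral_prod_dataset_mul_exp_le`. -/
theorem historyLaw_weight_ge_le (hneg : M.IsNegativeDensity neg C)
    (hh : h ∈ Finset.Icc 1 M.H) (hw : Measurable w) (he : Measurable e)
    (hwe : ∀ z, M.labelledMean neg h w z + e z ≤ 1) (k : ℕ) (c : ℝ≥0∞) :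
    alg.historyLaw k {D | c⁻¹ ≤ ((dataset D h).map w).prod *
      ENNReal.ofReal (Real.exp (alg.totalCost h e k D).toReal)} ≤ c := by
  have hm : Measurable fun D : History S A M.H k => ((dataset D h).map w).prod *
      ENNReal.ofReal (Real.exp (alg.totalCost h e k D).toReal) := by
    refine Measurable.mul ?_ ?_
    · simp_rw [prod_map_dataset]
      exact Finset.measurable_fun_prod _ fun j _ =>
        (measurable_prod_map_roundData hh hw).comp (measurable_pi_apply j)
    · have : Measurable (alg.totalCost h e k) := Finset.measurable_fun_sum _ fun j _ =>
        (alg.measurable_roundCost he h j).comp (measurable_take j)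
      fun_prop
  have h1 := (mul_meas_ge_le_lintegral (μ := alg.historyLaw k) hm c⁻¹).trans
    (alg.lintegral_prod_dataset_mul_exp_le hneg hh hw he hwe k)
  rwa [mul_comm, ← ENNReal.le_inv_iff_mul_le, inv_inv] at h1

end ContrastiveUCB

end ContrastiveRL

/-! ### Likelihood of the data and the error of one candidate -/

namespace ContrastiveRL

variable {S A : Type*} [MeasurableSpace S] [MeasurableSpace A]

theorem pointLoss_eq {t : ℝ} (ht : 0 ≤ t) {y : Bool} (h : pointLoss t y ≠ ⊤) :
    0 < labelProb t y ∧ (pointLoss t y).toReal = -Real.log (labelProb t y) := by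
  cases y with
  | false =>
    simp only [pointLoss, labelProb, Bool.false_eq_true, if_false]
    refine ⟨by positivity, ?_⟩
    rw [ENNReal.toReal_ofReal (Real.log_nonneg (by linarith)), one_div, Real.log_inv, neg_neg]
  | true =>
    simp only [pointLoss, labelProb, if_true] at h ⊢
    have h0 : t ≠ 0 := fun h0 => h (if_pos h0)
    have ht' : 0 < t := lt_of_le_of_ne ht h0.symm
    refine ⟨by positivity, ?_⟩
    rw [if_neg h0, ENNReal.toReal_ofReal (Real.log_nonneg (by
      have : 0 ≤ 1 / t := by positivity
      linarith)), ← Real.log_inv]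
    congr 1
    field_simp
    ring

theorem sqrtRatio_eq_exp {t₀ t : ℝ} (ht₀ : 0 ≤ t₀) (ht : 0 ≤ t) {y : Bool}
    (h₀ : pointLoss t₀ y ≠ ⊤) (h : pointLoss t y ≠ ⊤) :
    sqrtRatio t₀ t y =
      Real.exp (((pointLoss t₀ y).toReal - (pointLoss t y).toReal) / 2) := by
  obtain ⟨p₀, e₀⟩ := pointLoss_eq ht₀ h₀
  obtain ⟨p, e⟩ := pointLoss_eq ht h
  rw [e₀, e, sqrtRatio, Real.sqrt_eq_rpow, Real.rpow_def_of_pos (by positivity),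
    Real.log_div p.ne' p₀.ne']
  congr 1
  ring

theorem prod_sqrtRatio_eq_exp {X : Type*} (m : Multiset X) (t₀ t : X → ℝ) (y : X → Bool)
    (ht₀ : ∀ x, 0 ≤ t₀ x) (ht : ∀ x, 0 ≤ t x) (h₀ : ∀ x ∈ m, pointLoss (t₀ x) (y x) ≠ ⊤)
    (h : ∀ x ∈ m, pointLoss (t x) (y x) ≠ ⊤) :
    (m.map fun x => ENNReal.ofReal (sqrtRatio (t₀ x) (t x) (y x))).prod =
      ENNReal.ofReal (Real.exp (((m.map fun x => pointLoss (t₀ x) (y x)).sum.toReal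
        - (m.map fun x => pointLoss (t x) (y x)).sum.toReal) / 2)) := by
  have hsum : ∀ (m : Multiset X) (f : X → ℝ≥0∞), (∀ x ∈ m, f x ≠ ⊤) → (m.map f).sum ≠ ⊤ := by
    intro m f hf
    induction m using Multiset.induction with
    | empty => simp
    | cons a m ih =>
      rw [Multiset.map_cons, Multiset.sum_cons]
      exact ENNReal.add_ne_top.2 ⟨hf a (Multiset.mem_cons_self a m),
        ih fun x hx => hf x (Multiset.mem_cons_of_mem hx)⟩
  induction m using Multiset.induction with
  | empty => simp
  | cons a m ih =>
    rw [Multiset.forall_mem_cons] at h₀ h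
    simp only [Multiset.map_cons, Multiset.sum_cons, Multiset.prod_cons]
    rw [ih h₀.2 h.2, ENNReal.toReal_add h₀.1 (hsum _ _ h₀.2), ENNReal.toReal_add h.1 (hsum _ _ h.2),
      sqrtRatio_eq_exp (ht₀ a) (ht a) h₀.1 h.1, ← ENNReal.ofReal_mul (Real.exp_pos _).le,
      ← Real.exp_add]
    congr 2
    ring

/-- Candidates with smaller total loss than a reference of finite loss have larger likelihood. -/
theorem one_le_prod_sqrtRatio {X : Type*} (m : Multiset X) (t₀ t : X → ℝ) (y : X → Bool)
    (ht₀ : ∀ x, 0 ≤ t₀ x) (ht : ∀ x, 0 ≤ t x) (h₀ : ∀ x ∈ m, pointLoss (t₀ x) (y x) ≠ ⊤)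
    (hle : (m.map fun x => pointLoss (t x) (y x)).sum ≤
      (m.map fun x => pointLoss (t₀ x) (y x)).sum) :
    1 ≤ (m.map fun x => ENNReal.ofReal (sqrtRatio (t₀ x) (t x) (y x))).prod := by
  have htop : (m.map fun x => pointLoss (t₀ x) (y x)).sum ≠ ⊤ := by
    clear hle
    induction m using Multiset.induction with
    | empty => simp
    | cons a m ih =>
      rw [Multiset.forall_mem_cons] at h₀
      simp only [Multiset.map_cons, Multiset.sum_cons]
      exact ENNReal.add_ne_top.2 ⟨h₀.1, ih h₀.2⟩
  have h : ∀ x ∈ m, pointLoss (t x) (y x) ≠ ⊤ := fun x hx =>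
    ne_top_of_le_ne_top (ne_top_of_le_ne_top htop hle)
      (Multiset.single_le_sum (fun _ _ => zero_le) _ (Multiset.mem_map_of_mem _ hx))
  rw [prod_sqrtRatio_eq_exp m t₀ t y ht₀ ht h₀ h, ← ENNReal.ofReal_one]
  refine ENNReal.ofReal_le_ofReal (Real.one_le_exp ?_)
  have := ENNReal.toReal_mono htop hle
  linarith

namespace MDP

variable (M : MDP S A) {d : ℕ} {neg : S → ℝ} {C : ℝ} {h : ℕ}

/-- The squared `L¹` distance between the transition density and the normalized estimate. -/
noncomputable def sqError (neg : S → ℝ) (h : ℕ) (ψ : S → Feat d) (φ : S × A → Feat d)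
    (z : S × A) : ℝ≥0∞ :=
  (∫⁻ s', ‖M.P h z s' - M.PHat neg ψ φ z s'‖ₑ ∂M.vol) ^ 2

theorem measurable_sqError (hneg : M.IsNegativeDensity neg C) (hh : h ∈ Finset.Icc 1 M.H)
    {ψ : S → Feat d} {φ : S × A → Feat d} (hψ : Measurable ψ) (hφ : Measurable φ) :
    Measurable (M.sqError neg h ψ φ) := by
  have hn := hneg.measurable
  have hP := M.P_measurable h hh
  have hi : Measurable fun p : (S × A) × S => inner ℝ (φ p.1) (ψ p.2) :=
    (hφ.comp measurable_fst).inner (hψ.comp measurable_snd)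
  have hZ : Measurable fun z => ∫ s', neg s' * inner ℝ (φ z) (ψ s') ∂M.vol :=
    (StronglyMeasurable.integral_prod_right (ν := M.vol)
      (f := fun z s' => neg s' * inner ℝ (φ z) (ψ s'))
      ((hn.comp measurable_snd).mul hi).stronglyMeasurable).measurable
  have hPH : Measurable fun p : (S × A) × S => M.PHat neg ψ φ p.1 p.2 := by
    unfold PHat psiHat phiHat
    exact ((hn.comp measurable_snd).smul (hψ.comp measurable_snd)).inner
      ((hZ.inv.comp measurable_fst).smul (hφ.comp measurable_fst))
  unfold sqError
  refine Measurable.pow_const ?_ 2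
  exact Measurable.lintegral_prod_right' (ν := M.vol)
    (f := fun p : (S × A) × S => ‖M.P h p.1 p.2 - M.PHat neg ψ φ p.1 p.2‖ₑ)
    (hP.sub hPH).enorm

theorem lintegral_negMeasure (hneg : M.IsNegativeDensity neg C) (F : S → ℝ≥0∞) :
    ∫⁻ s, F s ∂M.negMeasure neg = ∫⁻ s, ENNReal.ofReal (neg s) * F s ∂M.vol := by
  rw [negMeasure, lintegral_withDensity_eq_lintegral_mul_non_measurable _
    hneg.measurable.ennreal_ofReal (Filter.Eventually.of_forall fun _ => ENNReal.ofReal_lt_top)]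
  rfl

theorem integral_negMeasure (hneg : M.IsNegativeDensity neg C) (F : S → ℝ) :
    ∫ s, F s ∂M.negMeasure neg = ∫ s, neg s * F s ∂M.vol := by
  rw [negMeasure, integral_withDensity_eq_integral_toReal_smul hneg.measurable.ennreal_ofReal
    (Filter.Eventually.of_forall fun _ => ENNReal.ofReal_lt_top)]
  refine integral_congr_ae (Filter.Eventually.of_forall fun s => ?_)
  simp [ENNReal.toReal_ofReal (hneg.pos.le.trans (hneg.le s))]

/-- The density ratio of the transition and the negative sampling distribution turns one into the
other. -/
theorem lintegral_trans_eq (hneg : M.IsNegativeDensity neg C) (hh : h ∈ Finset.Icc 1 M.H)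
    {g : S × A → S → ℝ} (hg : ∀ z s, M.P h z s = neg s * g z s) (z : S × A) (F : S → ℝ≥0∞) :
    ∫⁻ s, F s ∂M.trans h z = ∫⁻ s, ENNReal.ofReal (g z s) * F s ∂M.negMeasure neg := by
  have hP : Measurable fun s => ENNReal.ofReal (M.P h z s) :=
    ((M.P_measurable h hh).comp measurable_prodMk_left).ennreal_ofReal
  rw [M.trans_apply hh, lintegral_withDensity_eq_lintegral_mul_non_measurable _ hP
    (Filter.Eventually.of_forall fun _ => ENNReal.ofReal_lt_top), M.lintegral_negMeasure hneg]
  refine lintegral_congr fun s => ?_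
  rw [Pi.mul_apply, hg, ENNReal.ofReal_mul (hneg.pos.le.trans (hneg.le s)), mul_assoc]

theorem lintegral_ratio (hneg : M.IsNegativeDensity neg C) (hh : h ∈ Finset.Icc 1 M.H)
    {g : S × A → S → ℝ} (hg : ∀ z s, M.P h z s = neg s * g z s) (z : S × A) :
    ∫⁻ s, ENNReal.ofReal (g z s) ∂M.negMeasure neg = 1 := by
  have := M.isMarkovKernel_trans hh
  simpa using (M.lintegral_trans_eq hneg hh hg z fun _ => 1).symm

/-- Positive samples whose true density ratio vanishes have probability zero: giving them infinite
weight does not change the mean. -/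
theorem labelledMean_infinite_weight_le (hneg : M.IsNegativeDensity neg C)
    (hh : h ∈ Finset.Icc 1 M.H) {g : S × A → S → ℝ} (hg : ∀ z s, M.P h z s = neg s * g z s)
    (z : S × A) :
    M.labelledMean neg h (fun x => if pointLoss (g x.1 x.2.1) x.2.2 = ⊤ then ⊤ else 1) z ≤ 1 := by
  have := hneg.isProbabilityMeasure
  rw [labelledMean, M.lintegral_trans_eq hneg hh hg]
  have e1 : ∀ s, ENNReal.ofReal (g z s) * (if pointLoss (g z s) true = ⊤ then ⊤ else 1) =
      ENNReal.ofReal (g z s) := fun s => by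
    by_cases h0 : g z s = 0
    · simp [h0]
    · simp [pointLoss, h0]
  simp only [e1, M.lintegral_ratio hneg hh hg]
  simp only [pointLoss, Bool.false_eq_true, if_false, ENNReal.ofReal_ne_top, lintegral_one,
    measure_univ]
  rw [one_add_one_eq_two, ENNReal.div_self two_ne_zero ENNReal.ofNat_ne_top]

/-- The mean root likelihood ratio of a candidate loses at least a multiple of the squared error of
its normalized transition density. -/
theorem labelledMean_sqrtRatio_add_le (hneg : M.IsNegativeDensity neg C)
    (hh : h ∈ Finset.Icc 1 M.H) {g : S × A → S → ℝ} (hg : ∀ z s, M.P h z s = neg s * g z s)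
    {B : ℝ} (hB : 0 < B) (hgm : ∀ z, Measurable (g z)) (hg0 : ∀ z s, 0 ≤ g z s)
    (hgB : ∀ z s, g z s ≤ B) {ψ : S → Feat d} {φ : S × A → Feat d} (hψ : Measurable ψ)
    (hf0 : ∀ z s, 0 ≤ inner ℝ (ψ s) (φ z)) (hfB : ∀ z s, inner ℝ (ψ s) (φ z) ≤ B) (z : S × A) :
    M.labelledMean neg h
        (fun x => ENNReal.ofReal (sqrtRatio (g x.1 x.2.1) (inner ℝ (ψ x.2.1) (φ x.1)) x.2.2)) z
      + M.sqError neg h ψ φ z / ENNReal.ofReal (32 * B ^ 2) ≤ 1 := by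
  have := hneg.isProbabilityMeasure
  have hn0 : ∀ s, 0 ≤ neg s := fun s => hneg.pos.le.trans (hneg.le s)
  set ν := M.negMeasure neg
  set f : S → ℝ := fun s => inner ℝ (ψ s) (φ z) with hf
  have hfm : Measurable f := hψ.inner measurable_const
  have hg1 : ∫ s, g z s ∂ν = 1 := by
    rw [integral_eq_lintegral_of_nonneg_ae (Filter.Eventually.of_forall (hg0 z))
      (hgm z).aestronglyMeasurable, M.lintegral_ratio hneg hh hg, ENNReal.toReal_one]
  obtain ⟨hint, hle⟩ := integral_sqrtRatio_add_le (hgm z) hfm (hg0 z) (hf0 z) (hgB z) (hfB z) hg1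
  set Z := ∫ t, f t ∂ν with hZ
  have hZ' : ∫ s', neg s' * inner ℝ (φ z) (ψ s') ∂M.vol = Z := by
    rw [hZ, M.integral_negMeasure hneg]
    simp only [hf, real_inner_comm]
  have iX : Integrable (fun s => g z s - Z⁻¹ * f s) ν :=
    (integrable_of_nonneg_of_le (hgm z) (hg0 z) (hgB z)).sub
      ((integrable_of_nonneg_of_le hfm (hf0 z) (hfB z)).const_mul _)
  have hE : M.sqError neg h ψ φ z =
      ENNReal.ofReal ((∫ s, |g z s - Z⁻¹ * f s| ∂ν) ^ 2) := by
    have e : ∀ s', ‖M.P h z s' - M.PHat neg ψ φ z s'‖ₑ =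
        ENNReal.ofReal (neg s') * ‖g z s' - Z⁻¹ * f s'‖ₑ := fun s' => by
      rw [hg, PHat, psiHat, phiHat, hZ', real_inner_smul_left, real_inner_smul_right, ← mul_sub,
        enorm_mul, Real.enorm_of_nonneg (hn0 s')]
    rw [sqError]
    simp_rw [e]
    rw [← M.lintegral_negMeasure hneg, ← ofReal_integral_norm_eq_lintegral_enorm iX,
      ← ENNReal.ofReal_pow (integral_nonneg fun _ => norm_nonneg _)]
    simp only [Real.norm_eq_abs, ν]
  have hL : M.labelledMean neg h
      (fun x => ENNReal.ofReal (sqrtRatio (g x.1 x.2.1) (inner ℝ (ψ x.2.1) (φ x.1)) x.2.2)) z =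
      ENNReal.ofReal (∫ s, (g z s * sqrtRatio (g z s) (f s) true
        + sqrtRatio (g z s) (f s) false) / 2 ∂ν) := by
    have hm : ∀ y, Measurable fun s => sqrtRatio (g z s) (f s) y := fun y =>
      (measurable_sqrtRatio y).comp ((hgm z).prodMk hfm)
    have hr := fun s y => sqrtRatio_nonneg (g z s) (f s) y
    rw [ofReal_integral_eq_lintegral_ofReal hint (Filter.Eventually.of_forall fun s =>
        div_nonneg (add_nonneg (mul_nonneg (hg0 z s) (hr s _)) (hr s _)) zero_le_two),
      labelledMean, M.lintegral_trans_eq hneg hh hg]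
    have e : ∀ s, ENNReal.ofReal ((g z s * sqrtRatio (g z s) (f s) true
        + sqrtRatio (g z s) (f s) false) / 2) =
        (ENNReal.ofReal (g z s) * ENNReal.ofReal (sqrtRatio (g z s) (f s) true)
        + ENNReal.ofReal (sqrtRatio (g z s) (f s) false)) * 2⁻¹ := fun s => by
      rw [ENNReal.ofReal_div_of_pos two_pos,
        ENNReal.ofReal_add (mul_nonneg (hg0 z s) (hr s _)) (hr s _),
        ENNReal.ofReal_mul (hg0 z s), div_eq_mul_inv, ENNReal.ofReal_ofNat]
    simp_rw [e]
    have m1 : Measurable fun s =>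
        ENNReal.ofReal (g z s) * ENNReal.ofReal (sqrtRatio (g z s) (f s) true) :=
      (hgm z).ennreal_ofReal.mul (hm true).ennreal_ofReal
    have m2 : Measurable fun s =>
        ENNReal.ofReal (g z s) * ENNReal.ofReal (sqrtRatio (g z s) (f s) true)
          + ENNReal.ofReal (sqrtRatio (g z s) (f s) false) := m1.add (hm false).ennreal_ofReal
    rw [lintegral_mul_const _ m2, lintegral_add_left m1, div_eq_mul_inv]
  rw [hE, hL, ← ENNReal.ofReal_div_of_pos (by positivity), ← ENNReal.ofReal_add
    (integral_nonneg fun s => div_nonneg (add_nonneg (mul_nonneg (hg0 z s) (sqrtRatio_nonneg _ _ _))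
      (sqrtRatio_nonneg _ _ _)) zero_le_two) (by positivity)]
  exact ENNReal.ofReal_le_one.2 hle

end MDP

end ContrastiveRL

/-! ### The union bound -/

namespace ContrastiveRL

variable {S A : Type*} [MeasurableSpace S] [MeasurableSpace A]

theorem measurable_pointLoss : Measurable fun p : ℝ × Bool => pointLoss p.1 p.2 := by
  refine measurable_from_prod_countable_left fun y => ?_
  cases y
  · simp only [pointLoss, Bool.false_eq_true, if_false]
    fun_prop
  · simp only [pointLoss, if_true]
    exact Measurable.ite (measurableSet_singleton 0) measurable_const (by fun_prop)

theorem measurable_uncurry_sqrtRatio :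
    Measurable fun p : (ℝ × ℝ) × Bool => sqrtRatio p.1.1 p.1.2 p.2 :=
  measurable_from_prod_countable_left fun y => measurable_sqrtRatio y

variable [Fintype A] [Nonempty A]

namespace ContrastiveUCB

variable {M : MDP S A} {d : ℕ} {neg : S → ℝ} {Ψ : Finset (S → Feat d)}
  {Φ : Finset (S × A → Feat d)} {lam gam : ℕ → ℝ} {C : ℝ} {h : ℕ}
  (alg : ContrastiveUCB M neg Ψ Φ lam gam)

/-- The data set is non-empty after a round, so comparing averages of losses compares their sums. -/
theorem contrastive_sum_le {k : ℕ} (hk : 1 ≤ k) (hh : h ∈ Finset.Icc 1 M.H)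
    (D : History S A M.H k) {ψ : S → Feat d} {φ : S × A → Feat d} (hψ : ψ ∈ Ψ) (hφ : φ ∈ Φ) :
    ((dataset D h).map fun x =>
        pointLoss (inner ℝ (alg.ψt k h D x.2.1) (alg.φt k h D x.1)) x.2.2).sum ≤
      ((dataset D h).map fun x => pointLoss (inner ℝ (ψ x.2.1) (φ x.1)) x.2.2).sum := by
  have hcard : (dataset D h).card ≠ 0 := by
    have hx : tildeSample (D ⟨0, hk⟩) h ∈ dataset D h := by
      refine Multiset.mem_sum.2 ⟨⟨0, hk⟩, Finset.mem_univ _, ?_⟩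
      rw [roundData, Multiset.mem_add]
      exact Or.inl (Multiset.mem_singleton_self _)
    exact (Multiset.card_pos_iff_exists_mem.2 ⟨_, hx⟩).ne'
  have := alg.minimizes k hk h hh D ψ hψ φ hφ
  rw [contrastiveLoss, contrastiveLoss] at this
  rw [ENNReal.div_le_iff (by exact_mod_cast hcard) (ENNReal.natCast_ne_top _),
    ENNReal.div_mul_cancel (by exact_mod_cast hcard) (ENNReal.natCast_ne_top _)] at this
  exact this

/-- The empirical minimizer has at least the likelihood of any candidate with finite loss. -/
theorem one_le_prod_learned (hF : IsFunctionClass C Ψ Φ) {k : ℕ} (hk : 1 ≤ k)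
    (hh : h ∈ Finset.Icc 1 M.H) (D : History S A M.H k) {ψ : S → Feat d} {φ : S × A → Feat d}
    (hψ : ψ ∈ Ψ) (hφ : φ ∈ Φ)
    (hfin : ∀ x ∈ dataset D h, pointLoss (inner ℝ (ψ x.2.1) (φ x.1)) x.2.2 ≠ ⊤) :
    1 ≤ ((dataset D h).map fun x => ENNReal.ofReal (sqrtRatio (inner ℝ (ψ x.2.1) (φ x.1))
      (inner ℝ (alg.ψt k h D x.2.1) (alg.φt k h D x.1)) x.2.2)).prod :=
  one_le_prod_sqrtRatio (dataset D h) (fun x => inner ℝ (ψ x.2.1) (φ x.1))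
    (fun x => inner ℝ (alg.ψt k h D x.2.1) (alg.φt k h D x.1)) (fun x => x.2.2)
    (fun _ => hF.inner_nonneg _ hψ _ hφ _ _)
    (fun _ => hF.inner_nonneg _ (alg.ψt_mem k hk h hh D) _ (alg.φt_mem k hk h hh D) _ _)
    hfin (alg.contrastive_sum_le hk hh D hψ hφ)

/-- The mean squared error under both sampling mixtures is a share of the accumulated error. -/
theorem transitionError_le {k : ℕ} (D : History S A M.H k) {c : ℝ} (hc : 0 < c) :
    alg.transitionError k h D (alg.rhoTilde k h D) ≤ (k : ℝ≥0∞)⁻¹ * (ENNReal.ofReal c *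
        alg.totalCost h
          (fun z => M.sqError neg h (alg.ψt k h D) (alg.φt k h D) z / ENNReal.ofReal c) k D) ∧
    (2 ≤ h → alg.transitionError k h D (alg.rhoBreve k h D) ≤ (k : ℝ≥0∞)⁻¹ * (ENNReal.ofReal c *
        alg.totalCost h
          (fun z => M.sqError neg h (alg.ψt k h D) (alg.φt k h D) z / ENNReal.ofReal c) k D)) := by
  set E := M.sqError neg h (alg.ψt k h D) (alg.φt k h D) with hE
  have hc0 : ENNReal.ofReal c ≠ 0 := by simpa using hc
  have hmul : ∀ μ : Measure (S × A),
      ∫⁻ z, E z ∂μ = ENNReal.ofReal c * ∫⁻ z, E z / ENNReal.ofReal c ∂μ := fun μ => by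
    rw [← lintegral_const_mul' _ _ ENNReal.ofReal_ne_top]
    refine lintegral_congr fun z => ?_
    rw [ENNReal.mul_div_cancel hc0 ENNReal.ofReal_ne_top]
  have key : ∀ μ : Fin k → Measure (S × A), (∀ j, ∫⁻ z, E z / ENNReal.ofReal c ∂μ j ≤
      alg.roundCost h (fun z => E z / ENNReal.ofReal c) j (History.take D j)) →
      alg.transitionError k h D ((k : ℝ≥0∞)⁻¹ • ∑ j, μ j) ≤ (k : ℝ≥0∞)⁻¹ * (ENNReal.ofReal c *
        alg.totalCost h (fun z => E z / ENNReal.ofReal c) k D) := fun μ hμ => by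
    change ∫⁻ z, E z ∂_ ≤ _
    rw [lintegral_smul_measure, lintegral_finsetSum_measure, smul_eq_mul, totalCost,
      Finset.mul_sum _ _ (ENNReal.ofReal c)]
    gcongr with j
    rw [hmul]
    gcongr
    exact hμ j
  refine ⟨key _ fun j => le_self_add, fun h2 => key _ fun j => ?_⟩
  rw [roundCost, if_pos h2]
  exact le_add_self

/-- Data sets on which the true density ratio has infinite loss have probability zero. -/
theorem historyLaw_exists_pointLoss_eq_top (hneg : M.IsNegativeDensity neg C)
    (hh : h ∈ Finset.Icc 1 M.H) {g : S × A → S → ℝ} (hgm : Measurable (Function.uncurry g))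
    (hg : ∀ z s, M.P h z s = neg s * g z s) (k : ℕ) :
    alg.historyLaw k {D | ∃ x ∈ dataset D h, pointLoss (g x.1 x.2.1) x.2.2 = ⊤} = 0 := by
  classical
  -- With zero cost, the supermartingale bound makes the product of these weights finite a.s.
  set w : Sample S A → ℝ≥0∞ := fun x => if pointLoss (g x.1 x.2.1) x.2.2 = ⊤ then ⊤ else 1 with hw
  have hwm : Measurable w := by
    have hp : Measurable fun x : Sample S A => pointLoss (g x.1 x.2.1) x.2.2 :=
      measurable_pointLoss.comp ((hgm.comp (measurable_fst.prodMk
        (measurable_fst.comp measurable_snd))).prodMk (measurable_snd.comp measurable_snd))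
    exact Measurable.ite (hp (measurableSet_singleton ⊤)) measurable_const measurable_const
  have h0 := alg.historyLaw_weight_ge_le hneg hh hwm (e := fun _ => 0) measurable_const
    (fun z => by rw [add_zero]; exact M.labelledMean_infinite_weight_le hneg hh hg z) k 0
  refine le_antisymm ((measure_mono fun D hD => ?_).trans h0) zero_le
  obtain ⟨x, hx, hxt⟩ := hD
  have hprod : ∀ m : Multiset (Sample S A), 1 ≤ (m.map w).prod := fun m =>
    Multiset.one_le_prod fun a ha => by
      obtain ⟨y, -, rfl⟩ := Multiset.mem_map.1 ha
      simp only [hw]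
      split_ifs <;> simp
  obtain ⟨m, hm⟩ := Multiset.exists_cons_of_mem hx
  have ht : ((dataset D h).map w).prod = ⊤ := by
    rw [hm, Multiset.map_cons, Multiset.prod_cons, show w x = ⊤ from if_pos hxt,
      ENNReal.top_mul (zero_lt_one.trans_le (hprod m)).ne']
  rw [Set.mem_ofPred_eq, ht, ENNReal.top_mul (by simpa using Real.exp_pos _)]
  exact le_top

end ContrastiveUCB

/-- The union bound over `H n` candidates already gives the rate without the factor `2 k` inside the
logarithm. -/
theorem rate_le {X C δ k H n d : ℝ} (hd : 0 ≤ d) (hδ : 0 < δ) (hk : 1 ≤ k) (hN : 0 < H * n)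
    (hX : X ≤ Real.log (H * n / δ)) :
    k⁻¹ * (32 * (√d / C) ^ 2 * X) ≤ 32 * d / C ^ 2 * Real.log (2 * k * H * n / δ) / k := by
  have hlog : X ≤ Real.log (2 * k * H * n / δ) := by
    refine hX.trans (Real.log_le_log (by positivity) ?_)
    rw [mul_assoc (2 * k)]
    exact div_le_div_of_nonneg_right (le_mul_of_one_le_left hN.le (by linarith)) hδ.le
  rw [div_pow, Real.sq_sqrt hd, inv_mul_eq_div, mul_div_assoc 32 d]
  gcongr

/-- Transition recovery for any representation `neg * ⟨ψ₀, φ₀⟩` of the transition densities in the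
function class. -/
theorem transition_recovery {d : ℕ} (M : MDP S A) (ψ₀ : ℕ → S → Feat d) (φ₀ : ℕ → S × A → Feat d)
    (neg : S → ℝ) (C : ℝ) (hneg : M.IsNegativeDensity neg C)
    (hg : ∀ h ∈ Finset.Icc 1 M.H, ∀ z s, M.P h z s = neg s * inner ℝ (ψ₀ h s) (φ₀ h z))
    (Ψ : Finset (S → Feat d)) (Φ : Finset (S × A → Feat d)) (hF : IsFunctionClass C Ψ Φ)
    (hψs : ∀ h ∈ Finset.Icc 1 M.H, ψ₀ h ∈ Ψ) (hφs : ∀ h ∈ Finset.Icc 1 M.H, φ₀ h ∈ Φ)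
    (lam gam : ℕ → ℝ) (alg : ContrastiveUCB M neg Ψ Φ lam gam)
    (δ : ℝ) (hδ : 0 < δ) (k : ℕ) (hk : 1 ≤ k) :
    ENNReal.ofReal (1 - δ) ≤ alg.historyLaw k
      {D | (∀ h ∈ Finset.Icc 1 M.H,
              alg.transitionError k h D (alg.rhoTilde k h D) ≤
                ENNReal.ofReal (32 * d / C ^ 2 *
                  Real.log (2 * k * M.H * (Ψ.card * Φ.card) / δ) / k)) ∧
           (∀ h ∈ Finset.Icc 2 M.H,
              alg.transitionError k h D (alg.rhoBreve k h D) ≤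
                ENNReal.ofReal (32 * d / C ^ 2 *
                  Real.log (2 * k * M.H * (Ψ.card * Φ.card) / δ) / k))} := by
  set B : ℝ := Real.sqrt d / C with hB
  have hC := hneg.pos
  let g : ℕ → S × A → S → ℝ := fun h z s => inner ℝ (ψ₀ h s) (φ₀ h z)
  have inner_le : ∀ ψ ∈ Ψ, ∀ φ ∈ Φ, ∀ s z, inner ℝ (ψ s) (φ z) ≤ B := fun ψ hψ φ hφ s z =>
    (real_inner_le_norm _ _).trans (by
      calc ‖ψ s‖ * ‖φ z‖ ≤ B * 1 := mul_le_mul (hF.norm_ψ_le ψ hψ s) (hF.norm_φ_le φ hφ z)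
            (norm_nonneg _) (by positivity)
        _ = B := mul_one B)
  have hgm : ∀ h ∈ Finset.Icc 1 M.H, Measurable (Function.uncurry (g h)) := fun h hh =>
    ((hF.measurable_ψ _ (hψs h hh)).comp measurable_snd).inner
      ((hF.measurable_φ _ (hφs h hh)).comp measurable_fst)
  have hg0 : ∀ h ∈ Finset.Icc 1 M.H, ∀ z s, 0 ≤ g h z s := fun h hh z s =>
    hF.inner_nonneg _ (hψs h hh) _ (hφs h hh) s z
  have hgB : ∀ h ∈ Finset.Icc 1 M.H, ∀ z s, g h z s ≤ B := fun h hh z s =>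
    inner_le _ (hψs h hh) _ (hφs h hh) s z
  have h1 : 1 ∈ Finset.Icc 1 M.H := Finset.mem_Icc.2 ⟨le_rfl, M.H_pos⟩
  have hBpos : 0 < B := by
    obtain ⟨a⟩ := ‹Nonempty A›
    -- Otherwise every true ratio would vanish and the transition density could not have mass one.
    by_contra hneg'
    have hz : ∀ s, ENNReal.ofReal (g 1 (M.s₁, a) s) = 0 := fun s =>
      ENNReal.ofReal_of_nonpos ((hgB 1 h1 _ s).trans (not_lt.1 hneg'))
    have := M.lintegral_ratio (g := g 1) hneg h1 (hg 1 h1) (M.s₁, a)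
    simp [hz] at this
  have hΨ : 0 < Ψ.card := Finset.card_pos.2 ⟨_, hψs 1 h1⟩
  have hΦ : 0 < Φ.card := Finset.card_pos.2 ⟨_, hφs 1 h1⟩
  have hH := M.H_pos
  have hkR : (1 : ℝ) ≤ k := by exact_mod_cast hk
  have hHR : (1 : ℝ) ≤ M.H := by exact_mod_cast hH
  have hΨR : (1 : ℝ) ≤ Ψ.card := by exact_mod_cast hΨ
  have hΦR : (1 : ℝ) ≤ Φ.card := by exact_mod_cast hΦ
  set N : ℝ := M.H * (Ψ.card * Φ.card) with hN
  have hNpos : 0 < N := by positivity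
  have hc : 0 < 32 * B ^ 2 := by positivity
  set e : ℕ → (S → Feat d) → (S × A → Feat d) → S × A → ℝ≥0∞ := fun h ψ φ z =>
    M.sqError neg h ψ φ z / ENNReal.ofReal (32 * B ^ 2) with he
  set w : ℕ → (S → Feat d) → (S × A → Feat d) → Sample S A → ℝ≥0∞ := fun h ψ φ x =>
    ENNReal.ofReal (sqrtRatio (g h x.1 x.2.1) (inner ℝ (ψ x.2.1) (φ x.1)) x.2.2) with hw
  have hwe : ∀ h ∈ Finset.Icc 1 M.H, ∀ ψ ∈ Ψ, ∀ φ ∈ Φ, ∀ z,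
      M.labelledMean neg h (w h ψ φ) z + e h ψ φ z ≤ 1 := fun h hh ψ hψ φ hφ z =>
    M.labelledMean_sqrtRatio_add_le hneg hh (hg h hh) hBpos
      (fun z => (hgm h hh).comp measurable_prodMk_left) (hg0 h hh) (hgB h hh)
      (hF.measurable_ψ ψ hψ) (fun z s => hF.inner_nonneg ψ hψ φ hφ s z)
      (fun z s => inner_le ψ hψ φ hφ s z) z
  set null : ℕ → Set (History S A M.H k) := fun h =>
    {D | ∃ x ∈ dataset D h, pointLoss (g h x.1 x.2.1) x.2.2 = ⊤} with hnull
  -- With `δ / N` for each of the `N` triples `(h, ψ, φ)` the union bound costs `δ` in total.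
  set bad : ℕ → (S → Feat d) → (S × A → Feat d) → Set (History S A M.H k) := fun h ψ φ =>
    {D | (ENNReal.ofReal (δ / N))⁻¹ ≤ ((dataset D h).map (w h ψ φ)).prod *
      ENNReal.ofReal (Real.exp (alg.totalCost h (e h ψ φ) k D).toReal)} with hbad
  have hbad_le : ∀ h ∈ Finset.Icc 1 M.H, ∀ ψ ∈ Ψ, ∀ φ ∈ Φ,
      alg.historyLaw k (bad h ψ φ) ≤ ENNReal.ofReal (δ / N) := fun h hh ψ hψ φ hφ => by
    have hψm := hF.measurable_ψ ψ hψ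
    have hφm := hF.measurable_φ φ hφ
    refine alg.historyLaw_weight_ge_le hneg hh ?_
      ((M.measurable_sqError hneg hh hψm hφm).div_const _) (hwe h hh ψ hψ φ hφ) k _
    have hgx : Measurable fun x : Sample S A => g h x.1 x.2.1 :=
      (hgm h hh).comp (measurable_fst.prodMk (measurable_fst.comp measurable_snd))
    have hfx : Measurable fun x : Sample S A => (inner ℝ (ψ x.2.1) (φ x.1) : ℝ) :=
      (hψm.comp (measurable_fst.comp measurable_snd)).inner (hφm.comp measurable_fst)
    exact (measurable_uncurry_sqrtRatio.comp
      ((hgx.prodMk hfx).prodMk (measurable_snd.comp measurable_snd))).ennreal_ofReal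
  set bad_all : Set (History S A M.H k) := ⋃ h ∈ Finset.Icc 1 M.H,
    (null h ∪ ⋃ ψ ∈ Ψ, ⋃ φ ∈ Φ, bad h ψ φ) with hbad_all
  have hbad_all_le : alg.historyLaw k bad_all ≤ ENNReal.ofReal δ := by
    calc alg.historyLaw k bad_all
        ≤ ∑ h ∈ Finset.Icc 1 M.H, ∑ ψ ∈ Ψ, ∑ φ ∈ Φ, ENNReal.ofReal (δ / N) := by
          refine (measure_biUnion_finset_le _ _).trans (Finset.sum_le_sum fun h hh => ?_)
          refine (measure_union_le _ _).trans ?_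
          rw [alg.historyLaw_exists_pointLoss_eq_top hneg hh (hgm h hh) (hg h hh), zero_add]
          refine (measure_biUnion_finset_le _ _).trans (Finset.sum_le_sum fun ψ hψ => ?_)
          exact (measure_biUnion_finset_le _ _).trans
            (Finset.sum_le_sum fun φ hφ => hbad_le h hh ψ hψ φ hφ)
      _ = ENNReal.ofReal N * ENNReal.ofReal (δ / N) := by
          simp only [Finset.sum_const, Nat.card_Icc, Nat.add_sub_cancel, nsmul_eq_mul]
          rw [hN, ENNReal.ofReal_mul (by positivity), ENNReal.ofReal_mul (by positivity),
            ENNReal.ofReal_natCast, ENNReal.ofReal_natCast, ENNReal.ofReal_natCast]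
          ring
      _ = ENNReal.ofReal δ := by
          rw [← ENNReal.ofReal_mul hNpos.le, mul_div_cancel₀ _ hNpos.ne']
  set good : Set (History S A M.H k) := _
  change _ ≤ alg.historyLaw k good
  have hsub : bad_allᶜ ⊆ good := by
    intro D hD
    have hmain : ∀ h ∈ Finset.Icc 1 M.H, (k : ℝ≥0∞)⁻¹ * (ENNReal.ofReal (32 * B ^ 2) *
        alg.totalCost h (e h (alg.ψt k h D) (alg.φt k h D)) k D) ≤
        ENNReal.ofReal (32 * d / C ^ 2 *
          Real.log (2 * k * M.H * (Ψ.card * Φ.card) / δ) / k) := by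
      intro h hh
      have hψ := alg.ψt_mem k hk h hh D
      have hφ := alg.φt_mem k hk h hh D
      have hDnull : D ∉ null h := fun hm => hD (Set.mem_biUnion hh (Or.inl hm))
      have hDbad : D ∉ bad h (alg.ψt k h D) (alg.φt k h D) := fun hm => hD
        (Set.mem_biUnion hh (Or.inr (Set.mem_biUnion hψ (Set.mem_biUnion hφ hm))))
      set X := alg.totalCost h (e h (alg.ψt k h D) (alg.φt k h D)) k D with hX
      have hXtop : X ≠ ⊤ := alg.totalCost_ne_top hh
        (fun z => le_add_self.trans (hwe h hh _ hψ _ hφ z)) k D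
      have hone : 1 ≤ ((dataset D h).map (w h (alg.ψt k h D) (alg.φt k h D))).prod :=
        alg.one_le_prod_learned hF hk hh D (hψs h hh) (hφs h hh) fun x hx ht => hDnull ⟨x, hx, ht⟩
      have hlt : ENNReal.ofReal (Real.exp X.toReal) < ENNReal.ofReal (N / δ) := by
        have h2 := hDbad
        rw [hbad, Set.mem_ofPred_eq, not_le] at h2
        rw [← ENNReal.ofReal_inv_of_pos (by positivity), inv_div] at h2
        exact (le_mul_of_one_le_left zero_le hone).trans_lt h2
      have hlt' : X.toReal < Real.log (N / δ) :=
        (Real.lt_log_iff_exp_lt (by positivity)).2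
          ((ENNReal.ofReal_lt_ofReal_iff (by positivity)).1 hlt)
      rw [← ENNReal.ofReal_toReal hXtop, ← ENNReal.ofReal_mul hc.le,
        ← ENNReal.ofReal_natCast k, ← ENNReal.ofReal_inv_of_pos (by positivity),
        ← ENNReal.ofReal_mul (by positivity)]
      exact ENNReal.ofReal_le_ofReal (rate_le (Nat.cast_nonneg d) hδ hkR hNpos hlt'.le)
    refine ⟨fun h hh => (alg.transitionError_le D hc).1.trans (hmain h hh), fun h hh => ?_⟩
    rw [Finset.mem_Icc] at hh
    exact ((alg.transitionError_le D hc).2 hh.1).trans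
      (hmain h (Finset.mem_Icc.2 ⟨by omega, hh.2⟩))
  have := alg.isProbabilityMeasure_historyLaw hneg k
  -- `good` is not shown to be measurable: subadditivity of the outer measure is enough.
  have hone : 1 ≤ alg.historyLaw k good + ENNReal.ofReal δ := by
    calc (1 : ℝ≥0∞) = alg.historyLaw k (bad_allᶜ ∪ bad_all) := by
          rw [Set.compl_union_self, measure_univ]
      _ ≤ alg.historyLaw k bad_allᶜ + alg.historyLaw k bad_all := measure_union_le _ _
      _ ≤ _ := add_le_add (measure_mono hsub) hbad_all_le
  calc ENNReal.ofReal (1 - δ) = 1 - ENNReal.ofReal δ := by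
        rw [ENNReal.ofReal_sub _ hδ.le, ENNReal.ofReal_one]
    _ ≤ alg.historyLaw k good := tsub_le_iff_right.2 hone

end ContrastiveRL

open ContrastiveRL in
theorem lemma1 {S A : Type*} [MeasurableSpace S] [MeasurableSpace A] [MeasurableSingletonClass A]
    [Fintype A] [Nonempty A] {d : ℕ} (M : MDP S A)
    (ψs : ℕ → S → Feat d) (φs : ℕ → S × A → Feat d) (hlow : M.IsLowRank ψs φs)
    (neg : S → ℝ) (C : ℝ) (hneg : M.IsNegativeDensity neg C)
    (Ψ : Finset (S → Feat d)) (Φ : Finset (S × A → Feat d)) (hF : IsFunctionClass C Ψ Φ)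
    (hψs : ∀ h ∈ Finset.Icc 1 M.H, (fun s => (neg s)⁻¹ • ψs h s) ∈ Ψ)
    (hφs : ∀ h ∈ Finset.Icc 1 M.H, φs h ∈ Φ)
    (lam gam : ℕ → ℝ) (alg : ContrastiveUCB M neg Ψ Φ lam gam)
    (δ : ℝ) (hδ : 0 < δ) (k : ℕ) (hk : 1 ≤ k) :
    ENNReal.ofReal (1 - 2 * δ) ≤ alg.historyLaw k
      {D | (∀ h ∈ Finset.Icc 1 M.H,
              alg.transitionError k h D (alg.rhoTilde k h D) ≤
                ENNReal.ofReal (32 * d / C ^ 2 *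
                  Real.log (2 * k * M.H * (Ψ.card * Φ.card) / δ) / k)) ∧
           (∀ h ∈ Finset.Icc 2 M.H,
              alg.transitionError k h D (alg.rhoBreve k h D) ≤
                ENNReal.ofReal (32 * d / C ^ 2 *
                  Real.log (2 * k * M.H * (Ψ.card * Φ.card) / δ) / k))} := by
  have hn0 : ∀ s, 0 < neg s := fun s => hneg.pos.trans_le (hneg.le s)
  refine le_trans (ENNReal.ofReal_le_ofReal (by linarith))
    (transition_recovery M (fun h s => (neg s)⁻¹ • ψs h s) φs neg C hneg (fun h hh z s => ?_) Ψ Φ hF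
      hψs hφs lam gam alg δ hδ k hk)
  rw [hlow.eq_inner h hh, real_inner_smul_left, mul_inv_cancel_left₀ (hn0 s).ne']
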